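/- \textbf{Non-metric facility location.} There are $m\ge 1$ facilities with opening costs $c_f\in[0,\infty)$ and a set $V$ of potential clients (requests) with arbitrary connection costs $c_{fv}\in[0,\infty]$. A solution is a vector $z=(x,y)$ with $x_f,y_{fv}\in\{0,1\}$, $y_{fv}\le x_f$ for all $f,v$; it serves a set $W\subseteq V$ of clients if $\sum_f y_{fv}\ge 1$ for all $v\in W$. Its cost is $c(z)=\sum_f c_f x_f+\sum_{f,v}c_{fv}y_{fv}$, and $\mathrm{OPT}(W)$ is the least cost of a solution serving $W$. An online algorithm holds a coordinatewise non-decreasing solution that at every time serves all clients revealed so far. Algorithms may be randomized, and distributions on $V$ are discrete. \textbf{Corollary.} There is an absolute constant $C>0$ such that for all $m\ge 1$, $V$, $(c_f)$ and $(c_{fv})$ the following hold. (1) \emph{Single-sample prophet setting.} For every $n\ge1$ there is an online algorithm which receives one sample from each of $n$ unknown distributions $D^1,\dots,D^n$ on $V$, then faces independent clients $v^t\sim D^t$ ($t=1,\dots,n$, independent of the samples), and for all $D^1,\dots,D^n$ has expected cost at most $C(1+\log(mn))\cdot \mathbb E[\mathrm{OPT}(\{v^1,\dots,v^n\})]$.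 (2) \emph{2-stage prophet setting.} In the two-stage problem with markup $\lambda>0$, a policy buys a first-stage part $z_0$ before the clients $v^t\sim D^t$ (independent, $t=1,\dots,n$) arrive, and then a non-decreasing second-stage part $z_1$ during the sequence, so that the coordinatewise maximum $\max(z_0,z_1)$ is at all times a solution serving the clients that have arrived; it pays $c(z_0)+\lambda\, c(z_1)$ for the final $z_1$. For all $n\ge1$ and $\lambda>0$ there is an algorithm which receives $\lceil\lambda\rceil$ independent samples from each of the unknown $D^1,\dots,D^n$ before the first stage, and for all $D^1,\dots,D^n$ has expected cost at most $C(1+\log(mn))$ times the infimum, over all online two-stage policies (which may depend on $D^1,\dots,D^n$), of the expected cost. (3) \emph{Online-with-a-sample setting.} There is an algorithm such that, for every set $U$ of $n\ge1$ clients unknown to it and every $\alpha\in(0,1]$, if it is given upfront (and has to serve) a uniformly random subset $S\subseteq U$ of size $\lfloor\alpha n\rfloor$ and the clients of $U\setminus S$ then arrive one at a time in adversarial order (which may depend on $S$), its expected cost is at most $\frac{C(1+\log(mn))}{\alpha}\cdot\mathrm{OPT}(U)$. -/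

import Mathlib

open scoped ENNReal NNReal

universe u

noncomputable section

namespace OnlineIP

/-- A minimization integer program with requests in `V` and nonnegative integer variables
indexed by `ι`: each variable has a unit cost, and each set of requests has a set of
feasible solutions. -/
structure RequestProgram (V : Type*) (ι : Type*) where
  unitCost : ι → ℝ≥0∞
  Sols : Set V → Set (ι → ℕ)

variable {V : Type*} {ι : Type*}

/-- The cost `⟨c, z⟩` of a solution. -/
def RequestProgram.cost (P : RequestProgram V ι) (z : ι → ℕ) : ℝ≥0∞ :=
  ∑' i, P.unitCost i * (z i : ℝ≥0∞)

/-- The offline optimum for the request set `W` (`∞` if there is no feasible solution). -/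
def RequestProgram.opt (P : RequestProgram V ι) (W : Set V) : ℝ≥0∞ :=
  ⨅ z ∈ P.Sols W, P.cost z

/-- A deterministic online algorithm for the program `P` when the requests in `V₀` are given
upfront: `sol h` is the solution held after the requests in the list `h` have arrived (in
this order). Decisions are irrevocable (the solution only grows), and every request revealed
so far is satisfied. -/
structure OnlinePolicy (P : RequestProgram V ι) (V₀ : Set V) where
  sol : List V → ι → ℕ
  mono : ∀ (h : List V) (v : V), sol h ≤ sol (h ++ [v])
  feasible : ∀ h : List V, sol h ∈ P.Sols (V₀ ∪ {v | v ∈ h})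

/-- A deterministic two-stage policy: `first` is bought before the online sequence begins, and
`second h` is the (growing) part bought in the second stage, once the requests `h` have
arrived. The solution held is the coordinatewise maximum of the two parts. -/
structure TwoStagePolicy (P : RequestProgram V ι) where
  first : ι → ℕ
  second : List V → ι → ℕ
  mono : ∀ (h : List V) (v : V), second h ≤ second (h ++ [v])
  feasible : ∀ h : List V, first ⊔ second h ∈ P.Sols {v | v ∈ h}

/-- Total cost of a two-stage policy on the sequence `h`, with markup `lam` in stage two. -/
def TwoStagePolicy.totalCost {P : RequestProgram V ι} (π : TwoStagePolicy P) (lam : ℝ)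
    (h : List V) : ℝ≥0∞ :=
  P.cost π.first + ENNReal.ofReal lam * P.cost (π.second h)

/-- Expectation of a nonnegative function under a discrete distribution. -/
def expect {A : Type*} (p : PMF A) (g : A → ℝ≥0∞) : ℝ≥0∞ :=
  ∑' a, p a * g a

/-- Expectation over a family of independent draws `v i ∼ D i`. -/
def expectIndep {J : Type*} [Fintype J] (D : J → PMF V) (g : (J → V) → ℝ≥0∞) : ℝ≥0∞ :=
  ∑' v : J → V, (∏ i, D i (v i)) * g v

/-- Expectation over a uniformly random subset of `U` of size `k`. -/
def expectSubset (U : Finset V) (k : ℕ) (g : Finset V → ℝ≥0∞) : ℝ≥0∞ :=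
  (∑ S ∈ U.powersetCard k, g S) / ((U.powersetCard k).card : ℝ≥0∞)

/-- A randomized `k`-sample prophet algorithm for `n` requests, as a distribution over
deterministic algorithms. It receives `k` samples from each of the `n` unknown distributions
(`s (i, t)` is the `i`-th sample from the `t`-th distribution) and then plays online. -/
abbrev SampleProphetAlg (P : RequestProgram V ι) (k n : ℕ) :=
  PMF ((Fin k × Fin n → V) → OnlinePolicy P ∅)

/-- Expected cost of a `k`-sample prophet algorithm: the samples and the real sequence are
independent. -/
def SampleProphetAlg.expCost {P : RequestProgram V ι} {k n : ℕ} (A : SampleProphetAlg P k n)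
    (D : Fin n → PMF V) : ℝ≥0∞ :=
  expect A fun a =>
    expectIndep (fun p : Fin k × Fin n => D p.2) fun s =>
      expectIndep D fun v => P.cost ((a s).sol (List.ofFn v))

/-- Expected cost of the offline optimum in the prophet setting. -/
def prophetOpt (P : RequestProgram V ι) {n : ℕ} (D : Fin n → PMF V) : ℝ≥0∞ :=
  expectIndep D fun v => P.opt (Set.range v)

/-- A randomized two-stage prophet algorithm that uses `k` samples from each distribution. -/
abbrev TwoStageAlg (P : RequestProgram V ι) (k n : ℕ) :=
  PMF ((Fin k × Fin n → V) → TwoStagePolicy P)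

/-- Expected total cost of a two-stage prophet algorithm with markup `lam`. -/
def TwoStageAlg.expCost {P : RequestProgram V ι} {k n : ℕ} (A : TwoStageAlg P k n) (lam : ℝ)
    (D : Fin n → PMF V) : ℝ≥0∞ :=
  expect A fun a =>
    expectIndep (fun p : Fin k × Fin n => D p.2) fun s =>
      expectIndep D fun v => (a s).totalCost lam (List.ofFn v)

/-- Expected cost of the optimal two-stage online policy, which may depend on the
distributions. -/
def twoStageOnlineOpt (P : RequestProgram V ι) (lam : ℝ) {n : ℕ} (D : Fin n → PMF V) : ℝ≥0∞ :=
  ⨅ π : TwoStagePolicy P, expectIndep D fun v => π.totalCost lam (List.ofFn v)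

/-- A randomized online-with-a-sample algorithm: it receives a set `S` of requests upfront,
which it has to satisfy, and then plays online on the remaining ones. -/
abbrev OnlineWithSampleAlg (P : RequestProgram V ι) :=
  PMF ((S : Finset V) → OnlinePolicy P (S : Set V))

/-- `order` is a choice, for every possible sample `S`, of an order in which the requests of
`U` outside `S` arrive. -/
def IsArrivalOrder (U : Finset V) (order : Finset V → List V) : Prop :=
  ∀ S ⊆ U, (order S).Nodup ∧ ∀ v, v ∈ order S ↔ v ∈ U ∧ v ∉ S

/-- Expected cost of an online-with-a-sample algorithm when the request set is `U`, the sample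
is a uniformly random subset of `U` of size `k`, and the others arrive in the given order. -/
def OnlineWithSampleAlg.expCost {P : RequestProgram V ι} (A : OnlineWithSampleAlg P)
    (U : Finset V) (k : ℕ) (order : Finset V → List V) : ℝ≥0∞ :=
  expect A fun a => expectSubset U k fun S => P.cost ((a S).sol (order S))

/-- The integer program of (non-metric) facility location with facilities `Fin m` and potential
clients `V`: variables `x f` (open `f`) and `y (f, v)` (connect `v` to `f`) in `{0, 1}`, with
`y (f, v) ≤ x f`, and `∑ f, y (f, v) ≥ 1` for every requested client `v`. -/
def facilityLocation {m : ℕ} (openCost : Fin m → ℝ≥0) (connCost : Fin m → V → ℝ≥0∞) :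
    RequestProgram V (Fin m ⊕ Fin m × V) where
  unitCost := Sum.elim (fun f => (openCost f : ℝ≥0∞)) (fun p => connCost p.1 p.2)
  Sols W := {z | (∀ i, z i ≤ 1) ∧ (∀ f v, z (Sum.inr (f, v)) ≤ z (Sum.inl f)) ∧
    ∀ v ∈ W, 1 ≤ ∑ f, z (Sum.inr (f, v))}

end OnlineIP

end

/-! One deterministic plan serves all three settings. From the sample set `S`, choose a set `F` of
facilities minimising the opening costs plus `∑ v ∈ S, serveCost F v`; buy it and let every later
client use the facility that is cheapest for it relative to `F` alone. The cost is at most `opt S`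
plus that of serving the arriving clients that `S` missed. The core,
`IsExpBalanced.expect_missed_le`, bounds the expected missed cost by `O(1 + log m)` times the
expectation of `opt S`.

Since `F` depends on `S`, missed and collected service costs must be compared for all sets `A` of
facilities at once. For one weight function with values in `[0, 1]`, the exponential of half the
missed weight minus the collected weight has mean at most 1: it is a supermartingale when the
elements of `S` are drawn one by one (`expect_expWeight_insert_le`). A union bound with weights `m ^
(-|A|)`, of total at most `e`, makes the comparison uniform at a price `2 log m` per facility of
`A`, up to a random remainder (`IsExpBalanced.exists_remainder`).

This price is paid in units of the largest client cost, so clients are split into dyadic classes by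
stand-alone cost. At scale `2 ^ i`, facilities cheaper than `2 ^ i / 2` can be dropped at the loss
of a factor 2 (`serveCost_relevant_le`); hence each facility pays a geometric series, proportional
to its opening cost. The remainder of a class is charged to the probability that `S` meets it, and
meeting it forces `opt S ≥ 2 ^ i`, so these charges also form a geometric series.

What is left is to compare `opt S` with the benchmark of each setting. The argument yields `log m`;
the number of clients enters only when this is weakened to `log (m n)`. -/

noncomputable section

namespace OnlineIP

/-! ### Expectations under discrete distributions and independent draws. -/

section Expectation

variable {V : Type*}

theorem expect_mono {A : Type*} (p : PMF A) {g h : A → ℝ≥0∞} (H : ∀ a, g a ≤ h a) :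
    expect p g ≤ expect p h :=
  ENNReal.tsum_le_tsum fun a => mul_le_mul_right (H a) _

theorem expect_add {A : Type*} (p : PMF A) (g h : A → ℝ≥0∞) :
    expect p (fun a => g a + h a) = expect p g + expect p h := by
  simp only [expect, mul_add, ENNReal.tsum_add]

theorem expect_const_mul {A : Type*} (p : PMF A) (c : ℝ≥0∞) (g : A → ℝ≥0∞) :
    expect p (fun a => c * g a) = c * expect p g := by
  simp only [expect, ← ENNReal.tsum_mul_left]
  exact tsum_congr fun a => by ring

theorem expect_const {A : Type*} (p : PMF A) (c : ℝ≥0∞) : expect p (fun _ => c) = c := by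
  simp only [expect, ENNReal.tsum_mul_right, p.tsum_coe, one_mul]

theorem expect_tsum {A B : Type*} (p : PMF A) (g : B → A → ℝ≥0∞) :
    expect p (fun a => ∑' b, g b a) = ∑' b, expect p (g b) := by
  simp only [expect, ← ENNReal.tsum_mul_left]
  exact ENNReal.tsum_comm

theorem expect_sum {A B : Type*} (p : PMF A) (s : Finset B) (g : B → A → ℝ≥0∞) :
    expect p (fun a => ∑ b ∈ s, g b a) = ∑ b ∈ s, expect p (g b) := by
  simp only [expect, Finset.mul_sum]
  exact Summable.tsum_finsetSum fun _ _ => ENNReal.summable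

theorem expect_pure {A : Type*} (a : A) (g : A → ℝ≥0∞) : expect (PMF.pure a) g = g a := by
  rw [expect, tsum_eq_single a]
  · simp
  · intro b hb
    simp [PMF.pure_apply, hb]

theorem expectIndep_equiv {I J : Type*} [Fintype I] [Fintype J] (e : I ≃ J) (D : J → PMF V)
    (g : (J → V) → ℝ≥0∞) :
    expectIndep D g = expectIndep (fun i => D (e i)) fun w => g fun j => w (e.symm j) := by
  rw [expectIndep, expectIndep, ← (Equiv.arrowCongr e (Equiv.refl V)).tsum_eq]
  refine tsum_congr fun w => ?_
  congr 1
  rw [← e.prod_comp]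
  simp

theorem expectIndep_sum {I J : Type*} [Fintype I] [Fintype J] (D : I ⊕ J → PMF V)
    (g : (I ⊕ J → V) → ℝ≥0∞) :
    expectIndep D g = expectIndep (fun i => D (.inl i)) fun a =>
      expectIndep (fun j => D (.inr j)) fun b => g (Sum.elim a b) := by
  simp only [expectIndep]
  rw [← (Equiv.sumArrowEquivProdArrow I J V).symm.tsum_eq, ENNReal.tsum_prod']
  refine tsum_congr fun a => ?_
  rw [← ENNReal.tsum_mul_left]
  refine tsum_congr fun b => ?_
  simp only [Equiv.sumArrowEquivProdArrow, Equiv.coe_fn_symm_mk, Fintype.prod_sum_type,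
    Sum.elim_inl, Sum.elim_inr, mul_assoc]

theorem expectIndep_succ {N : ℕ} (D : Fin (N + 1) → PMF V) (g : (Fin (N + 1) → V) → ℝ≥0∞) :
    expectIndep D g = ∑' v, D 0 v *
      expectIndep (fun i : Fin N => D i.succ) fun w => g (Fin.cons v w) := by
  simp only [expectIndep]
  rw [← (Fin.consEquiv fun _ => V).tsum_eq, ENNReal.tsum_prod']
  refine tsum_congr fun a => ?_
  rw [← ENNReal.tsum_mul_left]
  refine tsum_congr fun b => ?_
  simp [Fin.consEquiv, Fin.prod_univ_succ, mul_assoc]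

theorem expectIndep_one {J : Type*} [Fintype J] (D : J → PMF V) :
    expectIndep D (fun _ => 1) = 1 := by
  rw [expectIndep_equiv (Fintype.equivFin J).symm]
  generalize (fun i => D ((Fintype.equivFin J).symm i)) = D'
  generalize Fintype.card J = N at D'
  induction N with
  | zero => simp [expectIndep]
  | succ N ih => simp [expectIndep_succ, ih, PMF.tsum_coe]

/-- The joint distribution of independent draws. -/
def indepPMF {J : Type*} [Fintype J] (D : J → PMF V) : PMF (J → V) :=
  ⟨fun v => ∏ i, D i (v i), by
    have h := expectIndep_one D
    simp only [expectIndep, mul_one] at h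
    exact h ▸ ENNReal.summable.hasSum⟩

theorem expectIndep_eq_expect {J : Type*} [Fintype J] (D : J → PMF V) (g : (J → V) → ℝ≥0∞) :
    expectIndep D g = expect (indepPMF D) g := rfl

/-- The coordinates outside the range of `e` integrate to 1. This extracts one run of `n` samples
from the `k × n` array. -/
theorem expectIndep_marginal {I J : Type*} [Fintype I] [Fintype J] (e : I ↪ J) (D : J → PMF V)
    (g : (I → V) → ℝ≥0∞) :
    expectIndep D (fun v => g fun i => v (e i)) = expectIndep (fun i => D (e i)) g := by
  classical
  let E : I ⊕ ↥(Set.range e)ᶜ ≃ J :=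
    ((Equiv.ofInjective e e.injective).sumCongr (Equiv.refl _)).trans (Equiv.Set.sumCompl _)
  have hE : ∀ i, E (.inl i) = e i := fun i => rfl
  have hE' : ∀ i, E.symm (e i) = .inl i := fun i => by rw [← hE, E.symm_apply_apply]
  rw [expectIndep_equiv E, expectIndep_sum]
  simp only [hE, hE', Sum.elim_inl]
  congr 1
  funext a
  rw [expectIndep_eq_expect, expect_const]

theorem expectIndep_apply {J : Type*} [Fintype J] (D : J → PMF V) (j : J) (g : V → ℝ≥0∞) :
    expectIndep D (fun v => g (v j)) = ∑' v, D j v * g v := by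
  refine (expectIndep_marginal ⟨fun _ : Fin 1 => j, Function.injective_of_subsingleton _⟩ D
    (fun w => g (w 0))).trans ?_
  rw [expectIndep_succ]
  simp [expectIndep]

end Expectation

/-! ### The exponential supermartingale for independent draws. -/

section Balanced

variable {V Ω : Type*}

theorem exp_neg_le_one_sub_half {y : ℝ} (h0 : 0 ≤ y) (h1 : y ≤ 1) :
    Real.exp (-y) ≤ 1 - y / 2 := by
  have h := Real.add_one_le_exp y
  rw [Real.exp_neg, inv_le_comm₀ (Real.exp_pos _) (by linarith)]
  refine le_trans ?_ h
  rw [inv_le_iff_one_le_mul₀ (by linarith)]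
  nlinarith

/-- The exponential weight comparing the `a`-mass of `x` outside `T` with the sum over `T`. -/
def expWeight (x a : V → ℝ≥0) (T : Finset V) : ℝ :=
  Real.exp (((∑' u, ((T : Set V)ᶜ).indicator (fun u => a u * x u) u : ℝ≥0) : ℝ) / 2 -
    ((∑ u ∈ T, x u : ℝ≥0) : ℝ))

theorem summable_indicator_mul {a x : V → ℝ≥0} (ha : Summable a) (hx : ∀ u, x u ≤ 1)
    (s : Set V) : Summable (s.indicator fun u => a u * x u) := by
  refine NNReal.summable_of_le (fun u => ?_) ha
  refine (Set.indicator_le_self' (fun _ _ => zero_le) u).trans ?_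
  exact mul_le_of_le_one_right (zero_le) (hx u)

theorem expWeight_le_expWeight {x a b : V → ℝ≥0} (hx : ∀ u, x u ≤ 1) (hb : Summable b)
    (T : Finset V) (hab : ∀ u ∉ T, a u ≤ b u) : expWeight x a T ≤ expWeight x b T := by
  refine Real.exp_le_exp.2 (sub_le_sub_right (div_le_div_of_nonneg_right ?_ zero_le_two) _)
  have hle : ∀ u, ((T : Set V)ᶜ).indicator (fun u => a u * x u) u ≤
      ((T : Set V)ᶜ).indicator (fun u => b u * x u) u := fun u => by
    by_cases hu : u ∈ T
    · simp [hu]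
    · simpa [hu] using mul_le_mul_left (hab u hu) _
  have hs := summable_indicator_mul hb hx ((T : Set V)ᶜ)
  exact NNReal.coe_le_coe.2 ((NNReal.summable_of_le hle hs).tsum_le_tsum hle hs)

-- One supermartingale step. The new mass raises the exponent by at most `q / 2`, where `q` is the
-- expected new weight outside `T`; the drawn element lowers it by its weight `y v`. Since `exp (-y)
-- ≤ 1 - y / 2` on `[0, 1]`, averaging gives the factor `exp (q / 2) * (1 - q / 2) ≤ 1`. The half in
-- the exponent of `expWeight` is what pays for this linearisation.
open Classical in
theorem expect_expWeight_insert_le (D : PMF V) {x a : V → ℝ≥0} (hx : ∀ u, x u ≤ 1)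
    (ha : Summable a) (T : Finset V) :
    expect D (fun v => ENNReal.ofReal
      (expWeight x (fun u => a u + (D u).toNNReal) (insert v T))) ≤
        ENNReal.ofReal (expWeight x a T) := by
  set d : V → ℝ≥0 := fun u => (D u).toNNReal with hd
  have hdc : ∀ u, (d u : ℝ≥0∞) = D u := fun u => ENNReal.coe_toNNReal (D.apply_ne_top u)
  have hds : Summable d := by
    rw [← ENNReal.tsum_coe_ne_top_iff_summable]
    simp [hdc, D.tsum_coe]
  -- Weights vanish on `T`: a repeated draw collects nothing, but mass on `T` is not counted as
  -- missed either.
  set y : V → ℝ≥0 := ((T : Set V)ᶜ).indicator x with hy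
  have hy1 : ∀ u, y u ≤ 1 := fun u =>
    (Set.indicator_le_self' (fun _ _ => zero_le) u).trans (hx u)
  have hy2 : ∀ v, y v / 2 ≤ 1 := fun v =>
    NNReal.div_le_of_le_mul ((hy1 v).trans (by norm_num))
  have hd1 : ∑' v, d v = 1 := by
    have := D.tsum_coe
    simp only [← hdc] at this
    rw [← ENNReal.coe_tsum hds] at this
    exact_mod_cast this
  have hdy : Summable fun u => d u * y u :=
    NNReal.summable_of_le (fun u => mul_le_of_le_one_right (zero_le) (hy1 u)) hds
  set q : ℝ≥0 := ∑' u, d u * y u with hq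
  have step : ∀ v, expWeight x (fun u => a u + d u) (insert v T) ≤
      expWeight x a T * Real.exp (q / 2) * (1 - y v / 2 : ℝ≥0) := by
    intro v
    have h1 : (∑' u, ((insert v T : Finset V) : Set V)ᶜ.indicator
        (fun u => (a u + d u) * x u) u) ≤
        (∑' u, ((T : Set V)ᶜ).indicator (fun u => a u * x u) u) + q := by
      rw [hq, ← (summable_indicator_mul ha hx _).tsum_add hdy]
      have hle : ∀ u, ((insert v T : Finset V) : Set V)ᶜ.indicator
          (fun u => (a u + d u) * x u) u ≤
          ((T : Set V)ᶜ).indicator (fun u => a u * x u) u + d u * y u := by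
        intro u
        by_cases hu : u ∈ T <;> by_cases huv : u = v <;>
          simp [hu, huv, hy, Set.indicator, add_mul]
      have hs := (summable_indicator_mul ha hx ((T : Set V)ᶜ)).add hdy
      exact (NNReal.summable_of_le hle hs).tsum_le_tsum hle hs
    have h2 : (∑ u ∈ insert v T, x u) = (∑ u ∈ T, x u) + y v := by
      by_cases hv : v ∈ T
      · simp [hv, hy]
      · simp [hv, hy, add_comm]
    have h3 : Real.exp (-(y v : ℝ)) ≤ ((1 - y v / 2 : ℝ≥0) : ℝ) := by
      rw [NNReal.coe_sub (hy2 v)]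
      exact exp_neg_le_one_sub_half (y v).2 (by exact_mod_cast hy1 v)
    refine le_trans ?_ (mul_le_mul_of_nonneg_left h3 (by unfold expWeight; positivity))
    unfold expWeight
    rw [← Real.exp_add, ← Real.exp_add, Real.exp_le_exp, h2]
    have h1' := NNReal.coe_le_coe.2 h1
    push_cast at h1' ⊢
    linarith
  set c : ℝ := expWeight x a T * Real.exp (q / 2) with hc
  have hc0 : 0 ≤ c := by rw [hc]; unfold expWeight; positivity
  have hsum : ∑' v, d v * (1 - y v / 2) = 1 - q / 2 := by
    have h1 : ∀ v, d v * (1 - y v / 2) + d v * y v / 2 = d v := by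
      intro v
      rw [mul_div_assoc, ← mul_add, tsub_add_cancel_of_le (hy2 v), mul_one]
    have h3 : Summable fun v => d v * (1 - y v / 2) :=
      NNReal.summable_of_le (fun v => mul_le_of_le_one_right (zero_le) tsub_le_self) hds
    have h4 : (∑' v, d v * (1 - y v / 2)) + q / 2 = 1 := by
      rw [hq, ← tsum_div_const, ← h3.tsum_add (hdy.div_const 2)]
      exact (tsum_congr h1).trans hd1
    exact eq_tsub_of_add_eq h4
  calc expect D (fun v => ENNReal.ofReal (expWeight x (fun u => a u + d u) (insert v T)))
      ≤ expect D (fun v => ENNReal.ofReal c * (1 - y v / 2 : ℝ≥0)) := by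
        refine expect_mono _ fun v => (ENNReal.ofReal_le_ofReal (step v)).trans ?_
        rw [ENNReal.ofReal_mul hc0, ENNReal.ofReal_coe_nnreal]
    _ = ENNReal.ofReal c * ((1 - q / 2 : ℝ≥0) : ℝ≥0∞) := by
        rw [expect_const_mul, ← hsum, ENNReal.coe_tsum]
        · simp only [expect, ← hdc, ENNReal.coe_mul]
        · exact NNReal.summable_of_le
            (fun v => mul_le_of_le_one_right (zero_le) tsub_le_self) hds
    _ ≤ ENNReal.ofReal (expWeight x a T) := by
        rw [← ENNReal.ofReal_coe_nnreal, ← ENNReal.ofReal_mul hc0]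
        refine ENNReal.ofReal_le_ofReal ?_
        have hq1 : q / 2 ≤ 1 := by
          have : q ≤ 1 := hd1 ▸
            hdy.tsum_le_tsum (fun u => mul_le_of_le_one_right zero_le (hy1 u)) hds
          exact NNReal.div_le_of_le_mul (this.trans (by norm_num))
        rw [NNReal.coe_sub hq1, hc, mul_assoc]
        refine mul_le_of_le_one_right (Real.exp_pos _).le ?_
        have := Real.add_one_le_exp (-(q / 2 : ℝ))
        calc Real.exp (q / 2) * (((1 : ℝ≥0) : ℝ) - ((q / 2 : ℝ≥0) : ℝ))
            ≤ Real.exp (q / 2) * Real.exp (-(q / 2 : ℝ)) := by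
              gcongr
              push_cast
              linarith
          _ = 1 := by rw [← Real.exp_add]; simp

/-- The random finite set `S` is *exponentially balanced* with respect to the mass function `μ`
if, for each bounded weight function, the `μ`-mass that it misses is controlled by the weight
that it collects. -/
structure IsExpBalanced (p : PMF Ω) (S : Ω → Finset V) (μ : V → ℝ≥0) : Prop where
  summable : Summable μ
  expect_le : ∀ x : V → ℝ≥0, (∀ u, x u ≤ 1) →
    expect p (fun ω => ENNReal.ofReal (expWeight x μ (S ω))) ≤ 1

theorem summable_toNNReal (D : PMF V) : Summable fun u => (D u).toNNReal := by
  rw [← ENNReal.tsum_coe_ne_top_iff_summable]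
  simp [ENNReal.coe_toNNReal (D.apply_ne_top _), D.tsum_coe]

-- Keeping `a` and `T` arbitrary lets the induction absorb the first draw into both of them.
open Classical in
theorem expectIndep_expWeight_le {N : ℕ} (D : Fin N → PMF V) {x : V → ℝ≥0}
    (hx : ∀ u, x u ≤ 1) {a : V → ℝ≥0} (ha : Summable a) (T : Finset V) :
    expectIndep D (fun w => ENNReal.ofReal (expWeight x
      (fun u => a u + ∑ i, (D i u).toNNReal) (T ∪ Finset.univ.image w))) ≤
        ENNReal.ofReal (expWeight x a T) := by
  induction N generalizing a T with
  | zero => simp [expectIndep]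
  | succ N ih =>
    rw [expectIndep_succ]
    refine le_trans ?_ (expect_expWeight_insert_le (D 0) hx ha T)
    refine expect_mono _ fun v => ?_
    refine le_trans (le_of_eq ?_)
      (ih (fun i => D i.succ) (ha.add (summable_toNNReal (D 0))) (insert v T))
    congr 1
    funext w
    congr 2
    · funext u
      rw [Fin.sum_univ_succ, add_assoc]
    · ext u
      simp [Fin.exists_fin_succ, eq_comm]
      tauto

open Classical in
theorem isExpBalanced_indep {J : Type*} [Fintype J] (D : J → PMF V) :
    IsExpBalanced (indepPMF D) (fun w => Finset.univ.image w)
      (fun u => ∑ j, (D j u).toNNReal) where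
  summable := summable_sum fun j _ => summable_toNNReal (D j)
  expect_le x hx := by
    rw [← expectIndep_eq_expect, expectIndep_equiv (Fintype.equivFin J).symm]
    have h := expectIndep_expWeight_le (fun i => D ((Fintype.equivFin J).symm i)) hx
      (a := fun _ => 0) summable_zero ∅
    have h1 : expWeight x (fun _ => 0) ∅ = 1 := by simp [expWeight]
    rw [h1, ENNReal.ofReal_one] at h
    refine le_trans (le_of_eq ?_) h
    congr 1
    funext w
    congr 2
    · funext u
      rw [zero_add, (Fintype.equivFin J).symm.sum_comp fun j => (D j u).toNNReal]
    · ext u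
      simp only [Finset.mem_image, Finset.mem_univ, true_and, Finset.empty_union]
      exact ⟨fun ⟨j, hj⟩ => ⟨_, hj⟩, fun ⟨i, hi⟩ => ⟨(Fintype.equivFin J).symm i, by simpa using hi⟩⟩

end Balanced

/-! ### Uniformly random subsets of fixed size are exponentially balanced. -/

section Subset

variable {V Ω : Type*}

theorem expect_uniformOfFinset (s : Finset Ω) (hs : s.Nonempty) (g : Ω → ℝ≥0∞) :
    expect (PMF.uniformOfFinset s hs) g = (∑ ω ∈ s, g ω) / (s.card : ℝ≥0∞) := by
  rw [expect, tsum_eq_sum (s := s)]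
  · rw [div_eq_mul_inv, mul_comm, Finset.mul_sum]
    exact Finset.sum_congr rfl fun ω hω => by rw [PMF.uniformOfFinset_apply_of_mem hs hω]
  · intro ω hω
    rw [PMF.uniformOfFinset_apply_of_notMem hs hω, zero_mul]

/-- The mass function that gives each element of `U` the mass `k / #U`. -/
def uniformMass (U : Finset V) (k : ℕ) : V → ℝ≥0 :=
  (U : Set V).indicator fun _ => (k : ℝ≥0) / U.card

theorem summable_uniformMass (U : Finset V) (k : ℕ) : Summable (uniformMass U k) :=
  summable_of_hasFiniteSupport (U.finite_toSet.subset Set.support_indicator_subset)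

-- Double counting of pairs: a set of size `k + 1` with a marked element is a set of size `k` with
-- an element added.
open Classical in
theorem sum_powersetCard_succ (U : Finset V) (k : ℕ) (g : Finset V → ℝ≥0∞) :
    ((k : ℝ≥0∞) + 1) * ∑ T ∈ U.powersetCard (k + 1), g T =
      ∑ S ∈ U.powersetCard k, ∑ u ∈ U \ S, g (insert u S) := by
  have h : ((k : ℝ≥0∞) + 1) * ∑ T ∈ U.powersetCard (k + 1), g T =
      ∑ T ∈ U.powersetCard (k + 1), ∑ u ∈ T, g T := by
    rw [Finset.mul_sum]
    refine Finset.sum_congr rfl fun T hT => ?_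
    rw [Finset.sum_const, (Finset.mem_powersetCard.1 hT).2]
    simp
  rw [h, Finset.sum_sigma', Finset.sum_sigma']
  refine Finset.sum_bij' (fun q _ => ⟨q.1.erase q.2, q.2⟩) (fun q _ => ⟨insert q.2 q.1, q.2⟩)
    ?_ ?_ ?_ ?_ ?_
  · rintro ⟨T, u⟩ hq
    simp only [Finset.mem_sigma, Finset.mem_powersetCard, Finset.mem_sdiff] at hq ⊢
    refine ⟨⟨(Finset.erase_subset _ _).trans hq.1.1, ?_⟩, hq.1.1 hq.2, by simp⟩
    rw [Finset.card_erase_of_mem hq.2, hq.1.2, Nat.add_sub_cancel]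
  · rintro ⟨S, u⟩ hq
    simp only [Finset.mem_sigma, Finset.mem_powersetCard, Finset.mem_sdiff] at hq ⊢
    refine ⟨⟨Finset.insert_subset hq.2.1 hq.1.1, ?_⟩, by simp⟩
    rw [Finset.card_insert_of_notMem hq.2.2, hq.1.2]
  · rintro ⟨T, u⟩ hq
    simp only [Finset.mem_sigma] at hq
    simp [Finset.insert_erase hq.2]
  · rintro ⟨S, u⟩ hq
    simp only [Finset.mem_sigma, Finset.mem_sdiff] at hq
    simp [Finset.erase_insert hq.2.2]
  · rintro ⟨T, u⟩ hq
    simp only [Finset.mem_sigma] at hq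
    simp [Finset.insert_erase hq.2]

/-- The subset is built by drawing without replacement, and each draw is a supermartingale step for
the uniform distribution on `U \ S`. -/
theorem sum_powersetCard_expWeight_le (U : Finset V) {x : V → ℝ≥0} (hx : ∀ u, x u ≤ 1) {k : ℕ}
    (hk : k ≤ U.card) :
    ∑ S ∈ U.powersetCard k, ENNReal.ofReal (expWeight x (uniformMass U k) S) ≤
      (U.card.choose k : ℝ≥0∞) := by
  classical
  induction k with
  | zero => simp [expWeight, uniformMass]
  | succ k ih =>
    have step : ∀ S ∈ U.powersetCard k,
        ∑ u ∈ U \ S, ENNReal.ofReal (expWeight x (uniformMass U (k + 1)) (insert u S)) ≤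
          ((U.card - k : ℕ) : ℝ≥0∞) * ENNReal.ofReal (expWeight x (uniformMass U k) S) := by
      intro S hS
      obtain ⟨hSU, hSk⟩ := Finset.mem_powersetCard.1 hS
      have hcard : (U \ S).card = U.card - k := by rw [Finset.card_sdiff_of_subset hSU, hSk]
      have hne : (U \ S).Nonempty := Finset.card_pos.1 (by omega)
      have h := expect_expWeight_insert_le (PMF.uniformOfFinset (U \ S) hne) hx
        (summable_uniformMass U k) S
      rw [expect_uniformOfFinset, ENNReal.div_le_iff_le_mul (by simp [hne.ne_empty]) (by simp),
        hcard, mul_comm] at h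
      refine le_trans (Finset.sum_le_sum fun u hu => ENNReal.ofReal_le_ofReal ?_) h
      -- The draw supplies mass `1 / (#U - k)` to each remaining element, at least the required
      -- increment `1 / #U`.
      refine expWeight_le_expWeight hx ((summable_uniformMass U k).add (summable_toNNReal _)) _ ?_
      intro w hw
      simp only [Finset.mem_insert, not_or] at hw
      by_cases hwU : w ∈ U
      · rw [PMF.uniformOfFinset_apply_of_mem hne (by simp [hwU, hw.2]), hcard]
        simp only [uniformMass, Finset.mem_coe, hwU, Set.indicator_of_mem, ENNReal.toNNReal_inv,
          ENNReal.toNNReal_natCast]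
        rw [Nat.cast_succ, add_div, one_div]
        have : ((U.card - k : ℕ) : ℝ≥0) ≤ U.card := by exact_mod_cast Nat.sub_le _ _
        have h0 : (0 : ℝ≥0) < ((U.card - k : ℕ) : ℝ≥0) := by
          exact_mod_cast (by omega : 0 < U.card - k)
        gcongr
      · simp [uniformMass, hwU]
    have hid := sum_powersetCard_succ U k
      fun T => ENNReal.ofReal (expWeight x (uniformMass U (k + 1)) T)
    have h1 : ((k : ℝ≥0∞) + 1) * ∑ T ∈ U.powersetCard (k + 1),
        ENNReal.ofReal (expWeight x (uniformMass U (k + 1)) T) ≤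
          ((k : ℝ≥0∞) + 1) * (U.card.choose (k + 1) : ℝ≥0∞) := by
      rw [hid]
      refine (Finset.sum_le_sum step).trans ?_
      rw [← Finset.mul_sum]
      refine (mul_le_mul_right (ih (by omega)) _).trans (le_of_eq ?_)
      have := Nat.choose_succ_right_eq U.card k
      rw [mul_comm, mul_comm ((k : ℝ≥0∞) + 1)]
      exact_mod_cast this.symm
    exact (ENNReal.mul_le_mul_iff_right (by simp) (by finiteness)).1 h1

theorem isExpBalanced_subset (U : Finset V) (k : ℕ) (hne : (U.powersetCard k).Nonempty) :
    IsExpBalanced (PMF.uniformOfFinset (U.powersetCard k) hne) (fun S => S)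
      (uniformMass U k) where
  summable := summable_uniformMass U k
  expect_le x hx := by
    rw [expect_uniformOfFinset]
    refine ENNReal.div_le_of_le_mul ?_
    rw [one_mul, Finset.card_powersetCard]
    exact sum_powersetCard_expWeight_le U hx (Finset.powersetCard_nonempty.1 hne)

end Subset

/-! ### Uniformity over all sets of facilities. -/

section Remainder

variable {V Ω : Type*} {p : PMF Ω} {S : Ω → Finset V} {μ : V → ℝ≥0}

/-- The probability that the random set `S` meets `K`. -/
def hitProb (p : PMF Ω) (S : Ω → Finset V) (K : Set V) : ℝ≥0∞ :=
  expect p ({ω | ∃ u ∈ S ω, u ∈ K}.indicator fun _ => 1)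

/-- With the indicator of `K` as weight, the exponential equals `exp (M / 2)` whenever `S` misses
`K`, so this has probability at most `exp (-M / 2)`. Then `1 - exp (-t) ≥ min 1 t / 2`. -/
theorem IsExpBalanced.min_mass_le (h : IsExpBalanced p S μ) (K : Set V) :
    min 1 (((∑' u, K.indicator μ u : ℝ≥0) : ℝ≥0∞) / 2) ≤ 2 * hitProb p S K := by
  classical
  set M : ℝ≥0 := ∑' u, K.indicator μ u with hM
  have h1 := h.expect_le (K.indicator fun _ => 1)
    fun u => Set.indicator_le_self' (fun _ _ => zero_le) u
  set miss : ℝ≥0∞ := expect p ({ω | ∃ u ∈ S ω, u ∈ K}ᶜ.indicator fun _ => 1) with hmiss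
  have htot : hitProb p S K + miss = 1 := by
    rw [hitProb, hmiss, ← expect_add]
    refine Eq.trans ?_ (expect_const p 1)
    congr 1
    funext ω
    exact Set.indicator_self_add_compl_apply {ω | ∃ u ∈ S ω, u ∈ K} (fun _ => (1 : ℝ≥0∞)) ω
  have h2 : ENNReal.ofReal (Real.exp (M / 2)) * miss ≤ 1 := by
    rw [hmiss, ← expect_const_mul]
    refine le_trans (expect_mono _ fun ω => ?_) h1
    by_cases hω : ω ∈ {ω | ∃ u ∈ S ω, u ∈ K}
    · simp [hω]
    · rw [Set.indicator_of_mem (by exact hω), mul_one]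
      refine ENNReal.ofReal_le_ofReal (Real.exp_le_exp.2 (le_of_eq ?_))
      have h3 : ∀ u ∈ S ω, u ∉ K := fun u hu huK => hω ⟨u, hu, huK⟩
      have h4 : ∑ u ∈ S ω, K.indicator (fun _ => (1 : ℝ≥0)) u = 0 :=
        Finset.sum_eq_zero fun u hu => by simp [h3 u hu]
      rw [h4, hM, NNReal.coe_zero, sub_zero]
      congr 2
      refine tsum_congr fun u => ?_
      by_cases huK : u ∈ K <;> by_cases huS : u ∈ S ω
      · exact absurd huK (h3 u huS)
      all_goals simp [huK, huS]
  have hexp : miss ≤ ENNReal.ofReal (Real.exp (-(M / 2 : ℝ))) := by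
    rw [Real.exp_neg, ENNReal.ofReal_inv_of_pos (Real.exp_pos _), ENNReal.le_inv_iff_mul_le,
      mul_comm]
    exact h2
  have hgoal : min 1 ((M : ℝ≥0∞) / 2) + 2 * miss ≤ 2 := by
    refine (add_le_add_right (mul_le_mul_right hexp _) _).trans ?_
    have e1 : min 1 ((M : ℝ≥0∞) / 2) = ENNReal.ofReal (min 1 ((M : ℝ) / 2)) := by
      rw [← NNReal.coe_two, ← NNReal.coe_one, ← NNReal.coe_div, ← NNReal.coe_min,
        ENNReal.ofReal_coe_nnreal, ENNReal.coe_min, ENNReal.coe_div two_ne_zero]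
      simp
    have e2 : (2 : ℝ≥0∞) = ENNReal.ofReal 2 := by simp
    rw [e1, e2, ← ENNReal.ofReal_mul zero_le_two,
      ← ENNReal.ofReal_add (le_min zero_le_one (by positivity)) (by positivity)]
    refine ENNReal.ofReal_le_ofReal ?_
    rcases le_total ((M : ℝ) / 2) 1 with hle | hle
    · rw [min_eq_right hle]
      linarith [exp_neg_le_one_sub_half (by positivity) hle]
    · rw [min_eq_left hle]
      have h5 := exp_neg_le_one_sub_half zero_le_one le_rfl
      have h6 : Real.exp (-((M : ℝ) / 2)) ≤ Real.exp (-1) := Real.exp_le_exp.2 (by linarith)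
      linarith
  have hm_top : 2 * miss ≠ ⊤ := by
    refine ENNReal.mul_ne_top (by simp) (ne_top_of_le_ne_top ENNReal.one_ne_top ?_)
    exact htot ▸ le_add_self
  refine (ENNReal.add_le_add_iff_right hm_top).1 (hgoal.trans (le_of_eq ?_))
  rw [← mul_add, htot, mul_one]

theorem sum_inv_pow_card_le {m : ℕ} (hm : 1 ≤ m) :
    ∑ A : Finset (Fin m), ((m : ℝ)⁻¹) ^ A.card ≤ 3 := by
  have h := Fintype.sum_pow_mul_eq_add_pow (Fin m) ((m : ℝ)⁻¹) 1
  simp only [one_pow, mul_one, Fintype.card_fin] at h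
  rw [h]
  have hm' : (0 : ℝ) < m := by exact_mod_cast hm
  calc ((m : ℝ)⁻¹ + 1) ^ m ≤ Real.exp ((m : ℝ)⁻¹) ^ m := by
        gcongr
        exact Real.add_one_le_exp _
    _ = Real.exp 1 := by rw [← Real.exp_nat_mul, mul_inv_cancel₀ hm'.ne']
    _ ≤ 3 := by linarith [Real.exp_one_lt_d9]

/-- Uniform comparison, over all sets `A` of facilities, of the missed mass of `x A` with the
collected weight of `x A`; the remainder is charged to the probability that `K` is met. -/
theorem IsExpBalanced.exists_remainder (h : IsExpBalanced p S μ) {m : ℕ} (hm : 1 ≤ m) (K : Set V)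
    (x : Finset (Fin m) → V → ℝ≥0) (hx : ∀ A u, x A u ≤ 1) (hxK : ∀ A, ∀ u ∉ K, x A u = 0) :
    ∃ R : Ω → ℝ≥0∞, expect p R ≤ 12 * hitProb p S K ∧ ∀ ω A,
      ∑' u, ((S ω : Set V)ᶜ).indicator (fun u => (μ u : ℝ≥0∞) * x A u) u ≤
        2 * ∑ u ∈ S ω, (x A u : ℝ≥0∞) + ENNReal.ofReal (2 * Real.log m) * A.card + R ω := by
  classical
  set M : ℝ≥0 := ∑' u, K.indicator μ u with hM
  -- The weight `m ^ (-|A|)` costs only `log m` per facility in the exponent, while the weights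
  -- total `(1 + 1 / m) ^ m ≤ e`.
  let Z : Ω → ℝ := fun ω => ∑ A : Finset (Fin m), ((m : ℝ)⁻¹) ^ A.card * expWeight (x A) μ (S ω)
  have hm' : (0 : ℝ) < m := by exact_mod_cast hm
  have hpos : ∀ A ω, 0 ≤ ((m : ℝ)⁻¹) ^ A.card * expWeight (x A) μ (S ω) := fun A ω => by
    unfold expWeight; positivity
  have hZ : expect p (fun ω => ENNReal.ofReal (Z ω)) ≤ 3 := by
    have e : ∀ ω, ENNReal.ofReal (Z ω) = ∑ A : Finset (Fin m),
        ENNReal.ofReal (((m : ℝ)⁻¹) ^ A.card) * ENNReal.ofReal (expWeight (x A) μ (S ω)) := by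
      intro ω
      rw [ENNReal.ofReal_sum_of_nonneg fun A _ => hpos A ω]
      exact Finset.sum_congr rfl fun A _ => ENNReal.ofReal_mul (by positivity)
    simp only [e, expect_sum, expect_const_mul]
    calc _ ≤ ∑ A : Finset (Fin m), ENNReal.ofReal (((m : ℝ)⁻¹) ^ A.card) :=
          Finset.sum_le_sum fun A _ => mul_le_of_le_one_right' (h.expect_le (x A) (hx A))
      _ = ENNReal.ofReal (∑ A : Finset (Fin m), ((m : ℝ)⁻¹) ^ A.card) :=
          (ENNReal.ofReal_sum_of_nonneg fun A _ => by positivity).symm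
      _ ≤ 3 := by
          simpa using ENNReal.ofReal_le_ofReal (sum_inv_pow_card_le hm)
  have hMs : Summable (K.indicator μ) :=
    NNReal.summable_of_le (fun u => Set.indicator_le_self' (fun _ _ => zero_le) u) h.summable
  -- The cap `M` is harmless, as no weight supported on `K` can miss more. It makes the expectation
  -- small when `K` has little mass, which the bound by `hitProb` requires.
  refine ⟨fun ω => min (2 * ENNReal.ofReal (Z ω)) M, ?_, ?_⟩
  · have h1 : expect p (fun ω => min (2 * ENNReal.ofReal (Z ω)) M) ≤ min 6 (M : ℝ≥0∞) := by
      refine le_min ?_ ?_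
      · refine (expect_mono p fun ω => min_le_left _ _).trans ?_
        rw [expect_const_mul]
        calc _ ≤ (2 : ℝ≥0∞) * 3 := mul_le_mul_right hZ _
          _ = 6 := by norm_num
      · exact (expect_mono p fun ω => min_le_right _ _).trans (expect_const p _).le
    have h2 : min 6 (M : ℝ≥0∞) ≤ 6 * min 1 ((M : ℝ≥0∞) / 2) := by
      rcases le_total 1 ((M : ℝ≥0∞) / 2) with h3 | h3
      · rw [min_eq_left h3, mul_one]
        exact min_le_left _ _
      · rw [min_eq_right h3]
        refine (min_le_right _ _).trans ?_
        calc (M : ℝ≥0∞) = 2 * ((M : ℝ≥0∞) / 2) :=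
              (ENNReal.mul_div_cancel (by simp) (by simp)).symm
          _ ≤ 6 * ((M : ℝ≥0∞) / 2) := by gcongr; norm_num
    refine h1.trans (h2.trans ?_)
    calc _ ≤ 6 * (2 * hitProb p S K) := mul_le_mul_right (h.min_mass_le K) _
      _ = 12 * hitProb p S K := by rw [← mul_assoc]; norm_num
  · intro ω A
    set X : ℝ≥0 := ∑' u, ((S ω : Set V)ᶜ).indicator (fun u => μ u * x A u) u with hX
    set Y : ℝ≥0 := ∑ u ∈ S ω, x A u with hY
    have hXs := summable_indicator_mul h.summable (hx A) ((S ω : Set V)ᶜ)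
    have e1 : ∑' u, ((S ω : Set V)ᶜ).indicator (fun u => (μ u : ℝ≥0∞) * x A u) u = X := by
      rw [hX, ENNReal.coe_tsum hXs]
      refine tsum_congr fun u => ?_
      by_cases hu : u ∈ S ω <;> simp [hu]
    have e2 : ∑ u ∈ S ω, (x A u : ℝ≥0∞) = Y := by rw [hY]; push_cast; rfl
    rw [e1, e2]
    have hXM : (X : ℝ≥0∞) ≤ M := by
      have hle : ∀ u, ((S ω : Set V)ᶜ).indicator (fun u => μ u * x A u) u ≤ K.indicator μ u := by
        intro u
        refine (Set.indicator_le_self' (fun _ _ => zero_le) u).trans ?_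
        by_cases hu : u ∈ K
        · simpa [hu] using mul_le_of_le_one_right zero_le (hx A u)
        · simp [hxK A u hu]
      exact ENNReal.coe_le_coe.2 (hXs.tsum_le_tsum hle hMs)
    have hlog : 0 ≤ Real.log m := Real.log_nonneg (by exact_mod_cast hm)
    have hXZ : (X : ℝ≥0∞) ≤ 2 * Y + ENNReal.ofReal (2 * Real.log m) * A.card +
        2 * ENNReal.ofReal (Z ω) := by
      -- A single term of `Z`; afterwards `t + 1 ≤ exp t` turns this into a linear bound on `X`.
      have h1 : Real.exp ((X : ℝ) / 2 - Y - A.card * Real.log m) ≤ Z ω := by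
        refine le_trans (le_of_eq ?_) (Finset.single_le_sum (fun A _ => hpos A ω)
          (Finset.mem_univ A))
        rw [sub_eq_add_neg, Real.exp_add, mul_comm, Real.exp_neg, Real.exp_nat_mul,
          Real.exp_log hm', inv_pow]
        rfl
      have h2 := (Real.add_one_le_exp _).trans h1
      have hZ0 : 0 ≤ Z ω := Finset.sum_nonneg fun A _ => hpos A ω
      have h3 : (X : ℝ) ≤ 2 * Y + 2 * Real.log m * A.card + 2 * Z ω := by linarith
      calc (X : ℝ≥0∞) = ENNReal.ofReal X := ENNReal.ofReal_coe_nnreal.symm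
        _ ≤ ENNReal.ofReal (2 * Y + 2 * Real.log m * A.card + 2 * Z ω) :=
            ENNReal.ofReal_le_ofReal h3
        _ = _ := by
            rw [ENNReal.ofReal_add (by positivity) (by positivity),
              ENNReal.ofReal_add (by positivity) (by positivity),
              ENNReal.ofReal_mul (by positivity), ENNReal.ofReal_mul (q := (A.card : ℝ))
              (by positivity), ENNReal.ofReal_mul (q := Z ω) (by positivity)]
            simp
    rw [← min_add_add_left]
    exact le_min hXZ (hXM.trans le_add_self)

end Remainder

/-! ### Costs in a general request program. -/

section Cost

variable {V ι : Type*} (P : RequestProgram V ι)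

theorem RequestProgram.cost_zero : P.cost 0 = 0 := by simp [RequestProgram.cost]

theorem RequestProgram.cost_sup_le (a b : ι → ℕ) : P.cost (a ⊔ b) ≤ P.cost a + P.cost b := by
  simp only [RequestProgram.cost, ← ENNReal.tsum_add, ← mul_add]
  refine ENNReal.tsum_le_tsum fun i => mul_le_mul_right ?_ _
  have : (a ⊔ b) i ≤ a i + b i := sup_le (Nat.le_add_right _ _) (Nat.le_add_left _ _)
  exact_mod_cast this

end Cost

/-! ### Facility location: optimal plans and the policies built from them. -/

section Facility

variable {V : Type*} {m : ℕ} (openCost : Fin m → ℝ≥0) (connCost : Fin m → V → ℝ≥0∞)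

/-- The least cost of serving the client `v` when the facilities in `F` are already open. -/
def serveCost (F : Finset (Fin m)) (v : V) : ℝ≥0∞ :=
  ⨅ f, (if f ∈ F then 0 else (openCost f : ℝ≥0∞)) + connCost f v

theorem serveCost_anti {F G : Finset (Fin m)} (h : F ⊆ G) (v : V) :
    serveCost openCost connCost G v ≤ serveCost openCost connCost F v := by
  refine iInf_mono fun f => add_le_add_left ?_ _
  by_cases hf : f ∈ F
  · simp [hf, h hf]
  · rw [if_neg hf]
    split_ifs <;> simp

theorem serveCost_le_connCost {F : Finset (Fin m)} {f : Fin m} (hf : f ∈ F) (v : V) :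
    serveCost openCost connCost F v ≤ connCost f v :=
  (iInf_le _ f).trans (by simp [hf])

theorem facilityLocation_cost (z : Fin m ⊕ Fin m × V → ℕ) :
    (facilityLocation openCost connCost).cost z =
      ∑ f, (openCost f : ℝ≥0∞) * (z (.inl f) : ℝ≥0∞) +
        ∑' v, ∑ f, connCost f v * (z (.inr (f, v)) : ℝ≥0∞) := by
  rw [RequestProgram.cost, Summable.tsum_sum ENNReal.summable ENNReal.summable, tsum_fintype,
    ENNReal.tsum_prod', ENNReal.tsum_comm]
  simp [facilityLocation, tsum_fintype]

theorem serveCost_empty_le_opt {W : Set V} {v : V} (hv : v ∈ W) :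
    serveCost openCost connCost ∅ v ≤ (facilityLocation openCost connCost).opt W := by
  refine le_iInf₂ fun z hz => ?_
  obtain ⟨-, h2, h3⟩ := hz
  obtain ⟨f, -, hf⟩ := Finset.exists_ne_zero_of_sum_ne_zero (Nat.one_le_iff_ne_zero.1 (h3 v hv))
  have hf1 : 1 ≤ z (.inr (f, v)) := Nat.one_le_iff_ne_zero.2 hf
  have hf2 : 1 ≤ z (.inl f) := hf1.trans (h2 f v)
  rw [facilityLocation_cost]
  refine (iInf_le _ f).trans (add_le_add ?_ ?_)
  · rw [if_neg (Finset.notMem_empty f)]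
    refine le_trans (le_mul_of_one_le_right' (by exact_mod_cast hf2)) (Finset.single_le_sum
      (f := fun f => (openCost f : ℝ≥0∞) * (z (.inl f) : ℝ≥0∞))
      (fun _ _ => zero_le) (Finset.mem_univ f))
  · refine le_trans (le_mul_of_one_le_right' (by exact_mod_cast hf1)) ((Finset.single_le_sum
      (f := fun f => connCost f v * (z (.inr (f, v)) : ℝ≥0∞))
      (fun _ _ => zero_le) (Finset.mem_univ f)).trans (ENNReal.le_tsum v))

/-- The cost of opening the facilities `F` and serving the clients `S` from them, where clients
may be served by opening additional facilities for them alone. -/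
def planCost (F : Finset (Fin m)) (S : Finset V) : ℝ≥0∞ :=
  ∑ f ∈ F, (openCost f : ℝ≥0∞) + ∑ v ∈ S, serveCost openCost connCost F v

/-- Only finitely many sets of facilities compete, so a minimiser exists without `opt` having to be
attained. The open facilities of any solution form a plan that costs no more than the solution. -/
theorem exists_planCost_le (S : Finset V) : ∃ F, planCost openCost connCost F S ≤
    (facilityLocation openCost connCost).opt S := by
  obtain ⟨F, -, hF⟩ := Finset.exists_min_image Finset.univ
    (fun F => planCost openCost connCost F S) Finset.univ_nonempty
  refine ⟨F, le_iInf₂ fun z hz => ?_⟩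
  obtain ⟨-, h2, h3⟩ := hz
  refine (hF (Finset.univ.filter fun f => 1 ≤ z (.inl f)) (Finset.mem_univ _)).trans ?_
  rw [facilityLocation_cost]
  refine add_le_add ?_ ?_
  · rw [Finset.sum_filter]
    refine Finset.sum_le_sum fun f _ => ?_
    split_ifs with h
    · exact le_mul_of_one_le_right' (by exact_mod_cast h)
    · exact zero_le
  · refine le_trans (Finset.sum_le_sum fun v hv => ?_) (ENNReal.sum_le_tsum S)
    obtain ⟨f, -, hf⟩ := Finset.exists_ne_zero_of_sum_ne_zero
      (Nat.one_le_iff_ne_zero.1 (h3 v hv))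
    have hf1 : 1 ≤ z (.inr (f, v)) := Nat.one_le_iff_ne_zero.2 hf
    have hfF : f ∈ Finset.univ.filter fun f => 1 ≤ z (.inl f) := by
      simpa using hf1.trans (h2 f v)
    refine (serveCost_le_connCost openCost connCost hfF v).trans ?_
    exact le_trans (le_mul_of_one_le_right' (by exact_mod_cast hf1)) (Finset.single_le_sum
      (f := fun f => connCost f v * (z (.inr (f, v)) : ℝ≥0∞))
      (fun _ _ => zero_le) (Finset.mem_univ f))

/-- The facilities opened by an optimal plan for the clients `S`. -/
def planFacilities (S : Finset V) : Finset (Fin m) :=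
  (exists_planCost_le openCost connCost S).choose

theorem planCost_planFacilities_le (S : Finset V) :
    planCost openCost connCost (planFacilities openCost connCost S) S ≤
      (facilityLocation openCost connCost).opt S :=
  (exists_planCost_le openCost connCost S).choose_spec

/-- The partial solution that opens the facilities `F`. -/
def openSol (F : Finset (Fin m)) : Fin m ⊕ Fin m × V → ℕ :=
  Sum.elim (fun f => if f ∈ F then 1 else 0) fun _ => 0

theorem cost_openSol (F : Finset (Fin m)) :
    (facilityLocation openCost connCost).cost (openSol F) = ∑ f ∈ F, (openCost f : ℝ≥0∞) := by
  rw [facilityLocation_cost]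
  simp [openSol, Finset.sum_ite_mem]

variable [Nonempty (Fin m)]

/-- The facility that serves `v` at least cost when the facilities in `F` are open. -/
def server (F : Finset (Fin m)) (v : V) : Fin m :=
  (exists_eq_ciInf_of_finite
    (f := fun f => (if f ∈ F then 0 else (openCost f : ℝ≥0∞)) + connCost f v)).choose

theorem server_spec (F : Finset (Fin m)) (v : V) :
    (if server openCost connCost F v ∈ F then 0
      else (openCost (server openCost connCost F v) : ℝ≥0∞)) +
        connCost (server openCost connCost F v) v = serveCost openCost connCost F v :=
  (exists_eq_ciInf_of_finite
    (f := fun f => (if f ∈ F then 0 else (openCost f : ℝ≥0∞)) + connCost f v)).choose_spec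

open Classical in
/-- The partial solution that connects the clients `W` when the facilities in `F` are open. -/
def serveSol (F : Finset (Fin m)) (W : Set V) : Fin m ⊕ Fin m × V → ℕ :=
  Sum.elim (fun f => if f ∉ F ∧ ∃ v ∈ W, server openCost connCost F v = f then 1 else 0)
    fun p => if p.2 ∈ W ∧ server openCost connCost F p.2 = p.1 then 1 else 0

/-- Each newly opened facility is charged to one client of `W` assigned to it, whose `serveCost`
includes that opening cost. -/
theorem cost_serveSol_le (F : Finset (Fin m)) (W : Set V) :
    (facilityLocation openCost connCost).cost (serveSol openCost connCost F W) ≤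
      ∑' v, W.indicator (serveCost openCost connCost F) v := by
  classical
  set g := server openCost connCost F with hg
  have h1 : ∀ f, (openCost f : ℝ≥0∞) * (serveSol openCost connCost F W (.inl f) : ℝ≥0∞) ≤
      ∑' v, if v ∈ W ∧ g v = f then (if f ∈ F then 0 else (openCost f : ℝ≥0∞)) else 0 := by
    intro f
    by_cases hf : f ∉ F ∧ ∃ v ∈ W, g v = f
    · obtain ⟨hfF, v, hv, hvf⟩ := hf
      refine le_trans ?_ (ENNReal.le_tsum v)
      rw [if_pos ⟨hv, hvf⟩, if_neg hfF]
      refine mul_le_of_le_one_right' ?_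
      simp only [serveSol, Sum.elim_inl]
      split_ifs <;> simp
    · simp only [serveSol, Sum.elim_inl, ← hg]
      rw [if_neg hf]
      simp
  rw [facilityLocation_cost]
  refine (add_le_add_left (Finset.sum_le_sum fun f _ => h1 f) _).trans ?_
  rw [← Summable.tsum_finsetSum fun _ _ => ENNReal.summable, ← ENNReal.tsum_add]
  refine ENNReal.tsum_le_tsum fun v => ?_
  rw [← Finset.sum_add_distrib]
  by_cases hv : v ∈ W
  · rw [Set.indicator_of_mem hv, ← server_spec, ← hg, Finset.sum_eq_single (g v)]
    · simp [serveSol, hv, ← hg]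
    · intro f _ hf
      simp [serveSol, hv, ← hg, hf.symm]
    · simp
  · simp [serveSol, hv]

theorem serveSol_mono (F : Finset (Fin m)) {W W' : Set V} (h : W ⊆ W') :
    serveSol openCost connCost F W ≤ serveSol openCost connCost F W' := by
  classical
  rintro (f | p)
  · simp only [serveSol, Sum.elim_inl]
    split_ifs with h1 h2
    · exact le_rfl
    · exact absurd ⟨h1.1, h1.2.imp fun v hv => ⟨h hv.1, hv.2⟩⟩ h2
    · exact zero_le_one
    · exact le_rfl
  · simp only [serveSol, Sum.elim_inr]
    split_ifs with h1 h2
    · exact le_rfl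
    · exact absurd ⟨h h1.1, h1.2⟩ h2
    · exact zero_le_one
    · exact le_rfl

/-- `server` depends on `F` and the client only, so clients do not influence each other's
assignment. -/
theorem serveSol_union (F : Finset (Fin m)) (W W' : Set V) :
    serveSol openCost connCost F (W ∪ W') =
      serveSol openCost connCost F W ⊔ serveSol openCost connCost F W' := by
  classical
  refine le_antisymm ?_ (sup_le (serveSol_mono _ _ _ Set.subset_union_left)
    (serveSol_mono _ _ _ Set.subset_union_right))
  rintro (f | p)
  · simp only [serveSol, Sum.elim_inl, Pi.sup_apply]
    by_cases h1 : f ∉ F ∧ ∃ v ∈ W, server openCost connCost F v = f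
    · rw [if_pos h1]
      exact le_sup_of_le_left (by split_ifs <;> simp)
    · by_cases h2 : f ∉ F ∧ ∃ v ∈ W', server openCost connCost F v = f
      · rw [if_pos h2]
        exact le_sup_of_le_right (by split_ifs <;> simp)
      · rw [if_neg]
        · exact zero_le
        · rintro ⟨hf, v, hv | hv, hvf⟩
          · exact h1 ⟨hf, v, hv, hvf⟩
          · exact h2 ⟨hf, v, hv, hvf⟩
  · simp only [serveSol, Sum.elim_inr, Pi.sup_apply, Set.mem_union]
    split_ifs <;> first | exact zero_le | (simp; done) | (exfalso; tauto)

theorem sup_mem_sols (F : Finset (Fin m)) (W : Set V) :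
    openSol F ⊔ serveSol openCost connCost F W ∈ (facilityLocation openCost connCost).Sols W := by
  classical
  refine ⟨?_, ?_, ?_⟩
  · rintro (f | p)
    · simp only [openSol, serveSol, Pi.sup_apply, Sum.elim_inl]
      split_ifs <;> simp
    · simp only [openSol, serveSol, Pi.sup_apply, Sum.elim_inr]
      split_ifs <;> simp
  · intro f v
    simp only [openSol, serveSol, Pi.sup_apply, Sum.elim_inl, Sum.elim_inr]
    by_cases h : v ∈ W ∧ server openCost connCost F v = f
    · by_cases hf : f ∈ F
      · simp only [hf, if_true]
        exact le_sup_of_le_left (by split_ifs; simp)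
      · rw [if_pos h, if_pos (⟨hf, v, h⟩ : f ∉ F ∧ ∃ v ∈ W, server openCost connCost F v = f)]
        simp
    · simp [h]
  · intro v hv
    refine le_trans ?_ (Finset.single_le_sum (fun _ _ => Nat.zero_le _)
      (Finset.mem_univ (server openCost connCost F v)))
    simp [openSol, serveSol, hv]

theorem tsum_indicator_coe_finset (S : Finset V) (d : V → ℝ≥0∞) :
    ∑' v, (S : Set V).indicator d v = ∑ v ∈ S, d v := by
  rw [tsum_eq_sum (s := S)]
  · exact Finset.sum_congr rfl fun v hv => by simp [hv]
  · intro v hv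
    simp [hv]

theorem tsum_indicator_ofFn_le {n : ℕ} (v : Fin n → V) (A : Set V) (d : V → ℝ≥0∞) :
    ∑' u, ({u | u ∈ List.ofFn v} ∩ A).indicator d u ≤ ∑ t, A.indicator d (v t) := by
  classical
  calc ∑' u, ({u | u ∈ List.ofFn v} ∩ A).indicator d u
      ≤ ∑' u, ∑ t, if v t = u then A.indicator d u else 0 := by
        refine ENNReal.tsum_le_tsum fun u => ?_
        by_cases hu : u ∈ List.ofFn v
        · obtain ⟨t, ht⟩ := List.mem_ofFn.1 hu
          refine le_trans ?_ (Finset.single_le_sum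
            (f := fun t => if v t = u then A.indicator d u else 0)
            (fun _ _ => zero_le) (Finset.mem_univ t))
          simp only [ht, if_true]
          exact Set.indicator_le_indicator_of_subset Set.inter_subset_right (fun _ => zero_le) u
        · rw [Set.indicator_of_notMem fun h => hu h.1]
          exact zero_le
    _ = ∑ t, A.indicator d (v t) := by
        rw [Summable.tsum_finsetSum fun _ _ => ENNReal.summable]
        refine Finset.sum_congr rfl fun t _ => ?_
        rw [tsum_eq_single (v t)]
        · simp
        · intro u hu
          simp [hu.symm]

/-- The online policy that opens the facilities of an optimal plan for `S`, connects the clients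
in `S`, and then connects each arriving client at least cost. -/
def planPolicy (S : Finset V) (V₀ : Set V) (hV : V₀ ⊆ S) :
    OnlinePolicy (facilityLocation openCost connCost) V₀ where
  sol h := openSol (planFacilities openCost connCost S) ⊔
    serveSol openCost connCost (planFacilities openCost connCost S) (S ∪ {v | v ∈ h})
  mono h v := sup_le_sup_left (serveSol_mono _ _ _ (Set.union_subset_union_right _
    fun u hu => by simp [show u ∈ h from hu])) _
  feasible h := by
    obtain ⟨h1, h2, h3⟩ := sup_mem_sols openCost connCost (planFacilities openCost connCost S)
      (S ∪ {v | v ∈ h})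
    exact ⟨h1, h2, fun v hv => h3 v (Set.union_subset_union_left _ hV hv)⟩

theorem cost_planPolicy_le (S : Finset V) (V₀ : Set V) (hV : V₀ ⊆ S) (h : List V) :
    (facilityLocation openCost connCost).cost
      ((planPolicy openCost connCost S V₀ hV).sol h) ≤
        (facilityLocation openCost connCost).opt S +
          ∑' u, ({u | u ∈ h} ∩ (S : Set V)ᶜ).indicator
            (serveCost openCost connCost (planFacilities openCost connCost S)) u := by
  set F := planFacilities openCost connCost S with hF
  have e : (S : Set V) ∪ {v | v ∈ h} = (S : Set V) ∪ ({u | u ∈ h} ∩ (S : Set V)ᶜ) := by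
    rw [← Set.sdiff_eq, Set.union_sdiff_self]
  have h1 : (planPolicy openCost connCost S V₀ hV).sol h = openSol F ⊔
    (serveSol openCost connCost F S ⊔
      serveSol openCost connCost F ({u | u ∈ h} ∩ (S : Set V)ᶜ)) := by
    rw [← serveSol_union, ← e]; rfl
  rw [h1, ← sup_assoc]
  refine (RequestProgram.cost_sup_le _ _ _).trans (add_le_add ?_ (cost_serveSol_le _ _ _ _))
  refine le_trans ?_ (planCost_planFacilities_le openCost connCost S)
  refine (RequestProgram.cost_sup_le _ _ _).trans (add_le_add (cost_openSol _ _ _).le ?_)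
  exact (cost_serveSol_le _ _ _ _).trans (tsum_indicator_coe_finset S _).le

/-- The two-stage policy that opens the facilities of an optimal plan for `S` and connects the
clients in `S` in the first stage, and connects each new client at least cost later. -/
def planTwoStage (S : Finset V) : TwoStagePolicy (facilityLocation openCost connCost) where
  first := openSol (planFacilities openCost connCost S) ⊔
    serveSol openCost connCost (planFacilities openCost connCost S) S
  second h := serveSol openCost connCost (planFacilities openCost connCost S)
    ({u | u ∈ h} ∩ (S : Set V)ᶜ)
  mono h v := serveSol_mono _ _ _ (Set.inter_subset_inter_left _
    fun u hu => by simp [show u ∈ h from hu])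
  feasible h := by
    rw [sup_assoc, ← serveSol_union]
    obtain ⟨h1, h2, h3⟩ := sup_mem_sols openCost connCost (planFacilities openCost connCost S)
      (S ∪ ({u | u ∈ h} ∩ (S : Set V)ᶜ))
    refine ⟨h1, h2, fun v hv => h3 v ?_⟩
    by_cases hvS : v ∈ S
    · exact Or.inl hvS
    · exact Or.inr ⟨hv, hvS⟩

theorem totalCost_planTwoStage_le (S : Finset V) (lam : ℝ) (h : List V) :
    (planTwoStage openCost connCost S).totalCost lam h ≤
      (facilityLocation openCost connCost).opt S + ENNReal.ofReal lam *
        ∑' u, ({u | u ∈ h} ∩ (S : Set V)ᶜ).indicator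
          (serveCost openCost connCost (planFacilities openCost connCost S)) u := by
  refine add_le_add ?_ (mul_le_mul_right (cost_serveSol_le _ _ _ _) _)
  refine le_trans ?_ (planCost_planFacilities_le openCost connCost S)
  refine (RequestProgram.cost_sup_le _ _ _).trans (add_le_add (cost_openSol _ _ _).le ?_)
  exact (cost_serveSol_le _ _ _ _).trans (tsum_indicator_coe_finset S _).le

/-- An online policy used in the second stage only. -/
def TwoStagePolicy.ofOnline {ι : Type*} {P : RequestProgram V ι} (π : OnlinePolicy P ∅) :
    TwoStagePolicy P where
  first := 0
  second := π.sol
  mono := π.mono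
  feasible h := by
    have e : (0 : ι → ℕ) ⊔ π.sol h = π.sol h := sup_eq_right.2 fun _ => zero_le
    rw [e]
    simpa using π.feasible h

end Facility

/-! ### Dyadic scales. -/

section Dyadic

theorem two_zpow_succ (i : ℤ) : (2 : ℝ≥0∞) ^ (i + 1) = 2 * 2 ^ i := by
  rw [ENNReal.zpow_add two_ne_zero ENNReal.ofNat_ne_top, zpow_one, mul_comm]

theorem lt_add_one_of_two_zpow {i j : ℤ} {t : ℝ≥0∞} (h1 : (2 : ℝ≥0∞) ^ i ≤ t)
    (h2 : t < 2 ^ (j + 1)) : i ≤ j := by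
  by_contra hlt
  exact absurd (ENNReal.zpow_le_of_le one_le_two (show j + 1 ≤ i by omega))
    (not_le.2 (h1.trans_lt h2))

/-- A geometric series, at most twice its top term `2 ^ (N + 1)` with `2 ^ N ≤ t`. It sums both the
prices of the facilities and the remainders of the classes. -/
theorem tsum_two_zpow_le (t : ℝ≥0∞) :
    ∑' i : ℤ, {i : ℤ | (2 : ℝ≥0∞) ^ i ≤ t}.indicator (fun i => (2 : ℝ≥0∞) ^ (i + 1)) i ≤
      4 * t := by
  rcases eq_or_ne t ⊤ with rfl | ht
  · simp [ENNReal.mul_top]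
  rcases eq_or_ne t 0 with rfl | h0
  · have : ∀ i : ℤ, ¬ (2 : ℝ≥0∞) ^ i ≤ 0 := fun i =>
      not_le.2 (ENNReal.zpow_pos two_ne_zero ENNReal.ofNat_ne_top i)
    simp [this]
  obtain ⟨N, hN1, hN2⟩ := ENNReal.exists_mem_Ico_zpow h0 ht ENNReal.one_lt_two ENNReal.ofNat_ne_top
  have hinj : Function.Injective fun j : ℕ => N - (j : ℤ) := fun a b hab => by
    simp only at hab
    omega
  have hsupp : Function.support ({i : ℤ | (2 : ℝ≥0∞) ^ i ≤ t}.indicator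
      fun i => (2 : ℝ≥0∞) ^ (i + 1)) ⊆ Set.range fun j : ℕ => N - (j : ℤ) := by
    intro i hi
    have hit : (2 : ℝ≥0∞) ^ i ≤ t := by
      by_contra hcon
      exact hi (Set.indicator_of_notMem (by exact hcon) _)
    have := lt_add_one_of_two_zpow hit hN2
    exact ⟨(N - i).toNat, by simp only; omega⟩
  rw [← hinj.tsum_eq hsupp]
  calc ∑' j : ℕ, {i : ℤ | (2 : ℝ≥0∞) ^ i ≤ t}.indicator (fun i => (2 : ℝ≥0∞) ^ (i + 1)) (N - j)
      ≤ ∑' j : ℕ, (2 : ℝ≥0∞) ^ (N + 1) * (2⁻¹) ^ j := by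
        refine ENNReal.tsum_le_tsum fun j => (Set.indicator_le_self' (fun _ _ => zero_le) _).trans
          (le_of_eq ?_)
        rw [show N - (j : ℤ) + 1 = (N + 1) + -(j : ℤ) by ring,
          ENNReal.zpow_add two_ne_zero ENNReal.ofNat_ne_top, ENNReal.zpow_neg, zpow_natCast,
          ENNReal.inv_pow]
    _ = 4 * 2 ^ N := by
        rw [ENNReal.tsum_mul_left, ENNReal.tsum_geometric, two_zpow_succ,
          ENNReal.one_sub_inv_two, inv_inv, mul_right_comm]
        norm_num
    _ ≤ 4 * t := mul_le_mul_right hN1 _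

end Dyadic

/-! ### Cost classes and the bound on the missed cost. -/

section MissedCost

variable {V Ω : Type*} {m : ℕ} (openCost : Fin m → ℝ≥0) (connCost : Fin m → V → ℝ≥0∞)

/-- The clients whose stand-alone cost lies in `[2 ^ i, 2 ^ (i + 1))`. -/
def costClass (i : ℤ) : Set V :=
  {v | (2 : ℝ≥0∞) ^ i ≤ serveCost openCost connCost ∅ v ∧
    serveCost openCost connCost ∅ v < 2 ^ (i + 1)}

/-- The facilities in `F` that are not too cheap to matter for `costClass i`. -/
def relevant (F : Finset (Fin m)) (i : ℤ) : Finset (Fin m) :=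
  F.filter fun f => (2 : ℝ≥0∞) ^ i ≤ 2 * openCost f

/-- For a dropped facility the opening cost is below `2 ^ i / 2`, but opening plus connection is at
least `2 ^ i`. So opening costs at most as much as connecting, and paying for it anew at most
doubles the cost. -/
theorem serveCost_relevant_le (F : Finset (Fin m)) {i : ℤ} {v : V}
    (hv : v ∈ costClass openCost connCost i) :
    serveCost openCost connCost (relevant openCost F i) v ≤
      2 * serveCost openCost connCost F v := by
  rw [serveCost, serveCost, ENNReal.mul_iInf_of_ne two_ne_zero ENNReal.ofNat_ne_top]
  refine iInf_mono fun f => ?_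
  by_cases hf : f ∈ F
  · by_cases hr : f ∈ relevant openCost F i
    · simp only [hf, hr, if_true, zero_add]
      exact le_mul_of_one_le_left' one_le_two
    · simp only [hf, hr, if_true, if_false, zero_add, two_mul]
      have h1 : 2 * (openCost f : ℝ≥0∞) < 2 ^ i := by
        by_contra hcon
        exact hr (Finset.mem_filter.2 ⟨hf, not_lt.1 hcon⟩)
      have h2 : serveCost openCost connCost ∅ v ≤ openCost f + connCost f v :=
        (iInf_le _ f).trans (by simp)
      have h3 := h1.le.trans (hv.1.trans h2)
      rw [two_mul, ENNReal.add_le_add_iff_left ENNReal.coe_ne_top] at h3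
      exact add_le_add_left h3 _
  · have hr : f ∉ relevant openCost F i := fun h => hf (Finset.mem_filter.1 h).1
    simp only [hf, hr, if_false]
    exact le_mul_of_one_le_left' one_le_two

theorem tsum_costClass_le (d : V → ℝ≥0∞) (v : V) :
    ∑' i, (costClass openCost connCost i).indicator d v ≤ d v := by
  by_cases h : ∃ i, v ∈ costClass openCost connCost i
  · obtain ⟨i, hi⟩ := h
    rw [tsum_eq_single i, Set.indicator_of_mem hi]
    intro j hj
    refine Set.indicator_of_notMem (fun hj' => hj ?_) _
    exact le_antisymm (lt_add_one_of_two_zpow hj'.1 hi.2) (lt_add_one_of_two_zpow hi.1 hj'.2)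
  · push Not at h
    simp [h]

theorem serveCost_le_tsum_costClass (F : Finset (Fin m)) {v : V}
    (hv : serveCost openCost connCost ∅ v ≠ ⊤) :
    serveCost openCost connCost F v ≤ ∑' i, (costClass openCost connCost i).indicator
      (serveCost openCost connCost (relevant openCost F i)) v := by
  rcases eq_or_ne (serveCost openCost connCost ∅ v) 0 with h0 | h0
  · exact (serveCost_anti openCost connCost (Finset.empty_subset F) v).trans (h0 ▸ zero_le)
  · obtain ⟨i, hi⟩ := ENNReal.exists_mem_Ico_zpow h0 hv ENNReal.one_lt_two ENNReal.ofNat_ne_top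
    refine le_trans ?_ (ENNReal.le_tsum i)
    rw [Set.indicator_of_mem (show v ∈ costClass openCost connCost i from hi)]
    exact serveCost_anti openCost connCost (Finset.filter_subset _ _) v

/-- The total price of the union bounds: each facility is relevant only at scales up to twice its
opening cost. -/
theorem tsum_card_relevant_le (F : Finset (Fin m)) :
    ∑' i : ℤ, (2 : ℝ≥0∞) ^ (i + 1) * (relevant openCost F i).card ≤
      8 * ∑ f ∈ F, (openCost f : ℝ≥0∞) := by
  calc ∑' i : ℤ, (2 : ℝ≥0∞) ^ (i + 1) * (relevant openCost F i).card
      = ∑' i : ℤ, ∑ f ∈ F, {i : ℤ | (2 : ℝ≥0∞) ^ i ≤ 2 * openCost f}.indicator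
          (fun i => (2 : ℝ≥0∞) ^ (i + 1)) i := by
        refine tsum_congr fun i => ?_
        rw [relevant, Finset.card_filter]
        push_cast
        rw [Finset.mul_sum]
        refine Finset.sum_congr rfl fun f _ => ?_
        simp [Set.indicator]
    _ = ∑ f ∈ F, ∑' i : ℤ, {i : ℤ | (2 : ℝ≥0∞) ^ i ≤ 2 * openCost f}.indicator
          (fun i => (2 : ℝ≥0∞) ^ (i + 1)) i :=
        Summable.tsum_finsetSum fun _ _ => ENNReal.summable
    _ ≤ ∑ f ∈ F, 4 * (2 * (openCost f : ℝ≥0∞)) :=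
        Finset.sum_le_sum fun f _ => tsum_two_zpow_le _
    _ = 8 * ∑ f ∈ F, (openCost f : ℝ≥0∞) := by
        rw [Finset.mul_sum]
        refine Finset.sum_congr rfl fun f _ => ?_
        rw [← mul_assoc]
        norm_num

variable {p : PMF Ω} {S : Ω → Finset V} {μ : V → ℝ≥0}

/-- Used to discard the clients of infinite stand-alone cost, which lie in no cost class. -/
theorem IsExpBalanced.mass_eq_zero (h : IsExpBalanced p S μ) {K : Set V}
    (hK : hitProb p S K = 0) {v : V} (hv : v ∈ K) : μ v = 0 := by
  have h1 := h.min_mass_le K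
  rw [hK, mul_zero, nonpos_iff_eq_zero] at h1
  have h2 : (∑' u, K.indicator μ u) = 0 := by
    rcases min_eq_iff.1 h1 with h3 | h3
    · exact absurd h3.1 one_ne_zero
    · simpa using h3.1
  have hs : Summable (K.indicator μ) :=
    NNReal.summable_of_le (fun u => Set.indicator_le_self' (fun _ _ => zero_le) u) h.summable
  have h3 := hs.tsum_eq_zero_iff.1 h2 v
  rwa [Set.indicator_of_mem hv] at h3

/-- The remainders of all cost classes, for facility location. -/
theorem IsExpBalanced.exists_class_remainder (h : IsExpBalanced p S μ) (hm : 1 ≤ m) (i : ℤ) :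
    ∃ R : Ω → ℝ≥0∞, expect p R ≤ 12 * hitProb p S (costClass openCost connCost i) ∧
      ∀ ω (A : Finset (Fin m)),
        ∑' u, ((S ω : Set V)ᶜ).indicator (fun u => (μ u : ℝ≥0∞) *
          (costClass openCost connCost i).indicator (serveCost openCost connCost A) u) u ≤
        2 * ∑ u ∈ S ω, (costClass openCost connCost i).indicator
            (serveCost openCost connCost A) u +
          ENNReal.ofReal (2 * Real.log m) * (2 ^ (i + 1) * A.card) + 2 ^ (i + 1) * R ω := by
  classical
  set K := costClass openCost connCost i with hK
  set s : ℝ≥0∞ := 2 ^ (i + 1) with hs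
  have hs0 : s ≠ 0 := (ENNReal.zpow_pos two_ne_zero ENNReal.ofNat_ne_top _).ne'
  have hst : s ≠ ⊤ := ENNReal.zpow_ne_top two_ne_zero ENNReal.ofNat_ne_top _
  -- Within the class, every serving cost is at most `s = 2 ^ (i + 1)`, so division by `s` gives
  -- admissible weights; the result is scaled back at the end.
  let x : Finset (Fin m) → V → ℝ≥0 := fun A =>
    K.indicator fun u => (serveCost openCost connCost A u / s).toNNReal
  have hle : ∀ A, ∀ u ∈ K, serveCost openCost connCost A u / s ≤ 1 := fun A u hu => by
    refine ENNReal.div_le_of_le_mul ?_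
    rw [one_mul]
    exact (serveCost_anti openCost connCost (Finset.empty_subset A) u).trans hu.2.le
  have hsx : ∀ A u, s * (x A u : ℝ≥0∞) = K.indicator (serveCost openCost connCost A) u := by
    intro A u
    by_cases hu : u ∈ K
    · simp only [x, Set.indicator_of_mem hu]
      rw [ENNReal.coe_toNNReal (ne_top_of_le_ne_top ENNReal.one_ne_top (hle A u hu)),
        ENNReal.mul_div_cancel hs0 hst]
    · simp [x, hu]
  obtain ⟨R, hR1, hR2⟩ := h.exists_remainder hm K x
    (fun A u => by
      by_cases hu : u ∈ K
      · simp only [x, Set.indicator_of_mem hu]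
        exact ENNReal.toNNReal_mono ENNReal.one_ne_top (hle A u hu)
      · simp [x, hu])
    (fun A u hu => by simp [x, hu])
  refine ⟨R, hR1, fun ω A => ?_⟩
  have h1 := mul_le_mul_right (hR2 ω A) s
  rw [← ENNReal.tsum_mul_left, mul_add, mul_add, mul_left_comm s 2, Finset.mul_sum,
    mul_left_comm s] at h1
  simp only [hsx] at h1
  refine le_trans (le_of_eq (tsum_congr fun u => ?_)) h1
  by_cases hu : u ∈ S ω
  · simp [hu]
  · simp [hu, ← hsx, mul_left_comm]

/-- If `S` is exponentially balanced, then the facilities of an optimal plan for `S` also serve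
the clients outside `S` well. -/
theorem IsExpBalanced.expect_missed_le (h : IsExpBalanced p S μ) (hm : 1 ≤ m) :
    expect p (fun ω => ∑' u, ((S ω : Set V)ᶜ).indicator (fun u => (μ u : ℝ≥0∞) *
      serveCost openCost connCost (planFacilities openCost connCost (S ω)) u) u) ≤
    ENNReal.ofReal (52 * (1 + Real.log m)) *
      expect p (fun ω => (facilityLocation openCost connCost).opt (S ω)) := by
  classical
  set O : Ω → ℝ≥0∞ := fun ω => (facilityLocation openCost connCost).opt (S ω) with hO
  have hlog : 0 ≤ Real.log m := Real.log_nonneg (by exact_mod_cast hm)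
  rcases eq_or_ne (expect p O) ⊤ with htop | htop
  · rw [htop, ENNReal.mul_top]
    · exact le_top
    · simpa using by positivity
  -- If `S` met such clients with positive probability, the expected optimum would be infinite, a
  -- case already excluded.
  have hinf : ∀ v, serveCost openCost connCost ∅ v = ⊤ → μ v = 0 := by
    intro v hv
    refine h.mass_eq_zero (K := {v | serveCost openCost connCost ∅ v = ⊤}) ?_ hv
    by_contra hne
    refine htop (top_le_iff.1 ?_)
    rw [← ENNReal.top_mul hne, hitProb, ← expect_const_mul]
    refine expect_mono _ fun ω => ?_
    by_cases hω : ω ∈ {ω | ∃ u ∈ S ω, u ∈ {v | serveCost openCost connCost ∅ v = ⊤}}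
    · obtain ⟨u, hu, hut⟩ := id hω
      have := serveCost_empty_le_opt openCost connCost (Finset.mem_coe.2 hu)
      rw [show serveCost openCost connCost ∅ u = ⊤ from hut, top_le_iff] at this
      simp [hO, this]
    · rw [Set.indicator_of_notMem hω, mul_zero]
      exact zero_le
  choose R hR1 hR2 using fun i => h.exists_class_remainder openCost connCost hm i
  set L : ℝ≥0∞ := ENNReal.ofReal (2 * Real.log m) with hL
  -- Uniformity in `A` is used here: for each outcome, `A` is the relevant part of the plan computed
  -- from `S ω` itself.
  have hpoint : ∀ ω, ∑' u, ((S ω : Set V)ᶜ).indicator (fun u => (μ u : ℝ≥0∞) *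
      serveCost openCost connCost (planFacilities openCost connCost (S ω)) u) u ≤
        (4 + L * 8) * O ω + ∑' i : ℤ, 2 ^ (i + 1) * R i ω := by
    intro ω
    set F := planFacilities openCost connCost (S ω) with hF
    have hplan := planCost_planFacilities_le openCost connCost (S ω)
    rw [← hF] at hplan
    have hopen : ∑ f ∈ F, (openCost f : ℝ≥0∞) ≤ O ω := le_self_add.trans hplan
    have hserve : ∑ u ∈ S ω, serveCost openCost connCost F u ≤ O ω := le_add_self.trans hplan
    calc ∑' u, ((S ω : Set V)ᶜ).indicator (fun u => (μ u : ℝ≥0∞) *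
          serveCost openCost connCost F u) u
        ≤ ∑' u, ∑' i, ((S ω : Set V)ᶜ).indicator (fun u => (μ u : ℝ≥0∞) *
            (costClass openCost connCost i).indicator
              (serveCost openCost connCost (relevant openCost F i)) u) u := by
          refine ENNReal.tsum_le_tsum fun u => ?_
          by_cases hu : u ∈ S ω
          · simp [hu]
          · have hu' : u ∈ (S ω : Set V)ᶜ := by simpa using hu
            rcases eq_or_ne (serveCost openCost connCost ∅ u) ⊤ with hut | hut
            · simp only [Set.indicator_of_mem hu', hinf u hut]
              simp
            · simp only [Set.indicator_of_mem hu', ENNReal.tsum_mul_left]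
              exact mul_le_mul_right (serveCost_le_tsum_costClass openCost connCost F hut) _
      _ = ∑' i, ∑' u, ((S ω : Set V)ᶜ).indicator (fun u => (μ u : ℝ≥0∞) *
            (costClass openCost connCost i).indicator
              (serveCost openCost connCost (relevant openCost F i)) u) u := ENNReal.tsum_comm
      _ ≤ ∑' i : ℤ, (2 * ∑ u ∈ S ω, (costClass openCost connCost i).indicator
            (fun u => 2 * serveCost openCost connCost F u) u +
          L * (2 ^ (i + 1) * (relevant openCost F i).card) + 2 ^ (i + 1) * R i ω) := by
          refine ENNReal.tsum_le_tsum fun i => (hR2 i ω (relevant openCost F i)).trans ?_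
          refine add_le_add_left (add_le_add_left (mul_le_mul_right
            (Finset.sum_le_sum fun u _ => ?_) _) _) _
          by_cases huK : u ∈ costClass openCost connCost i
          · simpa only [Set.indicator_of_mem huK] using
              serveCost_relevant_le openCost connCost F huK
          · simp [huK]
      _ = 2 * ∑ u ∈ S ω, ∑' i, (costClass openCost connCost i).indicator
            (fun u => 2 * serveCost openCost connCost F u) u +
          L * ∑' i : ℤ, 2 ^ (i + 1) * ((relevant openCost F i).card : ℝ≥0∞) +
            ∑' i : ℤ, 2 ^ (i + 1) * R i ω := by
          rw [ENNReal.tsum_add, ENNReal.tsum_add, ENNReal.tsum_mul_left, ENNReal.tsum_mul_left,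
            Summable.tsum_finsetSum fun _ _ => ENNReal.summable]
      _ ≤ 2 * (2 * O ω) + L * (8 * O ω) + ∑' i : ℤ, 2 ^ (i + 1) * R i ω := by
          gcongr
          · refine (Finset.sum_le_sum fun u _ =>
              tsum_costClass_le openCost connCost _ u).trans ?_
            rw [← Finset.mul_sum]
            exact mul_le_mul_right hserve _
          · exact (tsum_card_relevant_le openCost F).trans (mul_le_mul_right hopen _)
      _ = (4 + L * 8) * O ω + ∑' i : ℤ, 2 ^ (i + 1) * R i ω := by ring
  have hrem : expect p (fun ω => ∑' i : ℤ, 2 ^ (i + 1) * R i ω) ≤ 48 * expect p O := by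
    calc expect p (fun ω => ∑' i : ℤ, 2 ^ (i + 1) * R i ω)
        = ∑' i : ℤ, 2 ^ (i + 1) * expect p (R i) := by
          rw [expect_tsum]
          exact tsum_congr fun i => expect_const_mul _ _ _
      _ ≤ ∑' i : ℤ, 2 ^ (i + 1) * (12 * hitProb p S (costClass openCost connCost i)) :=
          ENNReal.tsum_le_tsum fun i => mul_le_mul_right (hR1 i) _
      _ = 12 * expect p (fun ω => ∑' i : ℤ, 2 ^ (i + 1) *
            {ω | ∃ u ∈ S ω, u ∈ costClass openCost connCost i}.indicator (fun _ => 1) ω) := by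
          rw [expect_tsum, ← ENNReal.tsum_mul_left]
          refine tsum_congr fun i => ?_
          rw [expect_const_mul, hitProb, mul_left_comm]
      -- A sampled client of class `i` gives `2 ^ i ≤ O ω`, so the classes met contribute at most a
      -- geometric series.
      _ ≤ 12 * expect p (fun ω => 4 * O ω) := by
          refine mul_le_mul_right (expect_mono _ fun ω => ?_) _
          refine le_trans (ENNReal.tsum_le_tsum fun i => ?_) (tsum_two_zpow_le (O ω))
          by_cases hω : ω ∈ {ω | ∃ u ∈ S ω, u ∈ costClass openCost connCost i}
          · obtain ⟨u, hu, huK⟩ := id hω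
            have := huK.1.trans (serveCost_empty_le_opt openCost connCost (Finset.mem_coe.2 hu))
            rw [Set.indicator_of_mem hω, mul_one,
              Set.indicator_of_mem (show i ∈ {i : ℤ | (2 : ℝ≥0∞) ^ i ≤ O ω} from this)]
          · rw [Set.indicator_of_notMem hω, mul_zero]
            exact zero_le
      _ = 48 * expect p O := by
          rw [expect_const_mul, ← mul_assoc]
          norm_num
  refine (expect_mono p hpoint).trans ?_
  rw [expect_add, expect_const_mul]
  refine (add_le_add_right hrem _).trans ?_
  rw [← add_mul]
  refine mul_le_mul_left ?_ _
  calc 4 + L * 8 + 48 = ENNReal.ofReal (4 + 2 * Real.log m * 8 + 48) := by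
        rw [ENNReal.ofReal_add (by positivity) (by norm_num),
          ENNReal.ofReal_add (by norm_num) (by positivity), ENNReal.ofReal_mul (by positivity)]
        simp [hL]
    _ ≤ _ := ENNReal.ofReal_le_ofReal (by linarith)

end MissedCost

/-! ### The three settings. -/

section Settings

variable {V : Type*} {m : ℕ} (openCost : Fin m → ℝ≥0) (connCost : Fin m → V → ℝ≥0∞)

theorem facilityLocation_opt_mono {W W' : Set V} (h : W ⊆ W') :
    (facilityLocation openCost connCost).opt W ≤ (facilityLocation openCost connCost).opt W' :=
  le_iInf₂ fun z hz => iInf₂_le z ⟨hz.1, hz.2.1, fun v hv => hz.2.2 v (h hv)⟩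

theorem finset_sup_mem_sols {J : Type*} [Fintype J] {z : J → Fin m ⊕ Fin m × V → ℕ}
    {W : J → Set V} (h : ∀ j, z j ∈ (facilityLocation openCost connCost).Sols (W j)) :
    (fun i => Finset.univ.sup fun j => z j i) ∈
      (facilityLocation openCost connCost).Sols (⋃ j, W j) := by
  refine ⟨fun i => Finset.sup_le fun j _ => (h j).1 i, fun f v =>
    Finset.sup_mono_fun fun j _ => (h j).2.1 f v, fun v hv => ?_⟩
  obtain ⟨j, hj⟩ := Set.mem_iUnion.1 hv
  exact ((h j).2.2 v hj).trans (Finset.sum_le_sum fun f _ =>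
    Finset.le_sup (f := fun j => z j (Sum.inr (f, v))) (Finset.mem_univ j))

theorem setOf_mem_ofFn {n : ℕ} (v : Fin n → V) : {u | u ∈ List.ofFn v} = Set.range v := by
  ext u
  simp [List.mem_ofFn]

-- By linearity, the expected missed cost of a fresh sequence is an integral against `∑ t, D t`. The
-- `k * n` samples have `k` times this mass, which explains the factor `k` on the left.
open Classical in
theorem mul_expectIndep_missed_le (hm : 1 ≤ m) (k : ℕ) {n : ℕ} (D : Fin n → PMF V) :
    (k : ℝ≥0∞) * expectIndep (fun p : Fin k × Fin n => D p.2) (fun s => expectIndep D fun v =>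
      ∑' u, ({u | u ∈ List.ofFn v} ∩ ((Finset.univ.image s : Finset V) : Set V)ᶜ).indicator
        (serveCost openCost connCost (planFacilities openCost connCost (Finset.univ.image s))) u) ≤
    ENNReal.ofReal (52 * (1 + Real.log m)) *
      expectIndep (fun p : Fin k × Fin n => D p.2) fun s =>
        (facilityLocation openCost connCost).opt ((Finset.univ.image s : Finset V) : Set V) := by
  refine le_trans ?_ ((isExpBalanced_indep fun p : Fin k × Fin n => D p.2).expect_missed_le
    openCost connCost hm)
  rw [expectIndep_eq_expect, ← expect_const_mul]
  refine expect_mono _ fun s => ?_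
  set S : Finset V := Finset.univ.image s with hS
  set d := serveCost openCost connCost (planFacilities openCost connCost S) with hd
  calc (k : ℝ≥0∞) * expectIndep D (fun v =>
        ∑' u, ({u | u ∈ List.ofFn v} ∩ (S : Set V)ᶜ).indicator d u)
      ≤ k * expectIndep D (fun v => ∑ t, (S : Set V)ᶜ.indicator d (v t)) :=
        mul_le_mul_right (expect_mono (indepPMF D) fun v => tsum_indicator_ofFn_le v _ _) _
    _ = k * ∑ t, ∑' u, D t u * (S : Set V)ᶜ.indicator d u := by
        rw [expectIndep_eq_expect, expect_sum]
        congr 1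
        exact Finset.sum_congr rfl fun t _ => expectIndep_apply D t _
    _ = ∑' u, (S : Set V)ᶜ.indicator (fun u =>
          ((∑ p : Fin k × Fin n, (D p.2 u).toNNReal : ℝ≥0) : ℝ≥0∞) * d u) u := by
        rw [← Summable.tsum_finsetSum fun _ _ => ENNReal.summable, ← ENNReal.tsum_mul_left]
        refine tsum_congr fun u => ?_
        rw [← Finset.sum_mul, ← mul_assoc]
        by_cases hu : u ∈ S
        · simp [hu]
        · have hu' : u ∈ (S : Set V)ᶜ := by simpa using hu
          rw [Set.indicator_of_mem hu', Set.indicator_of_mem hu', Fintype.sum_prod_type]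
          push_cast
          simp [ENNReal.coe_toNNReal (PMF.apply_ne_top _ _)]
    _ ≤ _ := le_rfl

open Classical in
theorem expectIndep_opt_one {n : ℕ} (D : Fin n → PMF V) :
    expectIndep (fun p : Fin 1 × Fin n => D p.2) (fun s =>
      (facilityLocation openCost connCost).opt ((Finset.univ.image s : Finset V) : Set V)) =
    prophetOpt (facilityLocation openCost connCost) D := by
  rw [prophetOpt]
  refine Eq.trans ?_ (expectIndep_marginal
    ⟨fun t : Fin n => ((0 : Fin 1), t), fun a b h => (Prod.mk.inj h).2⟩
    (fun p : Fin 1 × Fin n => D p.2) fun v =>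
      (facilityLocation openCost connCost).opt (Set.range v))
  congr 1
  funext s
  congr 1
  ext u
  simp [Fin.exists_fin_one]
  rfl

theorem one_add_log_le {a b : ℕ} (ha : 1 ≤ a) (hb : 1 ≤ b) :
    1 + Real.log a ≤ 1 + Real.log (a * b) := by
  have ha' : (0 : ℝ) < a := by exact_mod_cast ha
  have hb' : (1 : ℝ) ≤ b := by exact_mod_cast hb
  exact add_le_add_right (Real.log_le_log ha' (le_mul_of_one_le_right ha'.le hb')) _

theorem add_ofReal_mul_le {c l l' : ℝ} (hc : 0 ≤ c) (hl : 0 ≤ l) (h1 : 1 ≤ l') (h : l ≤ l')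
    (a : ℝ≥0∞) : a + ENNReal.ofReal (c * l) * a ≤ ENNReal.ofReal ((1 + c) * l') * a := by
  have e : a + ENNReal.ofReal (c * l) * a = ENNReal.ofReal (1 + c * l) * a := by
    rw [ENNReal.ofReal_add zero_le_one (by positivity), ENNReal.ofReal_one, add_mul, one_mul]
  rw [e]
  refine mul_le_mul_left (ENNReal.ofReal_le_ofReal ?_) _
  nlinarith [mul_le_mul_of_nonneg_left h hc]

/-- When the second stage is no dearer than the first, every purchase costs at least `lam` times its
base price, and the two parts together are an offline solution. -/
theorem lam_mul_prophetOpt_le {lam : ℝ} (h1 : lam ≤ 1) {n : ℕ} (D : Fin n → PMF V) :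
    ENNReal.ofReal lam * prophetOpt (facilityLocation openCost connCost) D ≤
      twoStageOnlineOpt (facilityLocation openCost connCost) lam D := by
  refine le_iInf fun π => ?_
  rw [prophetOpt, expectIndep_eq_expect, ← expect_const_mul]
  refine expect_mono _ fun v => ?_
  have h2 : (facilityLocation openCost connCost).opt (Set.range v) ≤
      (facilityLocation openCost connCost).cost π.first +
        (facilityLocation openCost connCost).cost (π.second (List.ofFn v)) := by
    rw [← setOf_mem_ofFn]
    exact (iInf₂_le _ (π.feasible _)).trans (RequestProgram.cost_sup_le _ _ _)
  refine (mul_le_mul_right h2 _).trans ?_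
  rw [mul_add]
  exact add_le_add_left (mul_le_of_le_one_left' (ENNReal.ofReal_le_one.2 h1)) _

-- Run any policy separately on each of the `k` rows of samples and join the results. The common
-- first stage is bought once and the second stage `k` times, which the markup covers up to the
-- factor 2.
open Classical in
theorem expectIndep_opt_le_twoStage {lam : ℝ} {k : ℕ} (hk : (k : ℝ) ≤ 2 * lam) {n : ℕ}
    (D : Fin n → PMF V) :
    expectIndep (fun p : Fin k × Fin n => D p.2) (fun s =>
      (facilityLocation openCost connCost).opt ((Finset.univ.image s : Finset V) : Set V)) ≤
    2 * twoStageOnlineOpt (facilityLocation openCost connCost) lam D := by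
  set P := facilityLocation openCost connCost with hP
  rw [twoStageOnlineOpt, ENNReal.mul_iInf_of_ne two_ne_zero ENNReal.ofNat_ne_top]
  refine le_iInf fun π => ?_
  have hpoint : ∀ s : Fin k × Fin n → V,
      P.opt ((Finset.univ.image s : Finset V) : Set V) ≤
        P.cost π.first + ∑ j, P.cost (π.second (List.ofFn fun t => s (j, t))) := by
    intro s
    have hmem := finset_sup_mem_sols openCost connCost (J := Fin k)
      (fun j => π.feasible (List.ofFn fun t => s (j, t)))
    have hsub : ((Finset.univ.image s : Finset V) : Set V) ⊆
        ⋃ j, {u | u ∈ List.ofFn fun t => s (j, t)} := by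
      intro v hv
      obtain ⟨⟨j, t⟩, -, hjt⟩ := Finset.mem_image.1 (Finset.mem_coe.1 hv)
      exact Set.mem_iUnion.2 ⟨j, List.mem_ofFn.2 ⟨t, hjt⟩⟩
    refine (facilityLocation_opt_mono openCost connCost hsub).trans
      ((iInf₂_le _ hmem).trans ?_)
    · simp only [RequestProgram.cost]
      rw [← Summable.tsum_finsetSum fun _ _ => ENNReal.summable, ← ENNReal.tsum_add]
      refine ENNReal.tsum_le_tsum fun i => ?_
      rw [← Finset.mul_sum, ← mul_add]
      refine mul_le_mul_right ?_ _
      have : (Finset.univ.sup fun j => (π.first ⊔ π.second (List.ofFn fun t => s (j, t))) i) ≤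
          π.first i + ∑ j, π.second (List.ofFn fun t => s (j, t)) i := by
        refine Finset.sup_le fun j _ => sup_le (Nat.le_add_right _ _) ?_
        exact (Finset.single_le_sum (f := fun j => π.second (List.ofFn fun t => s (j, t)) i)
          (fun _ _ => Nat.zero_le _) (Finset.mem_univ j)).trans (Nat.le_add_left _ _)
      exact_mod_cast this
  set E : ℝ≥0∞ := expectIndep D fun v => P.cost (π.second (List.ofFn v)) with hE
  calc expectIndep (fun p : Fin k × Fin n => D p.2)
        (fun s => P.opt ((Finset.univ.image s : Finset V) : Set V))
      ≤ expectIndep (fun p : Fin k × Fin n => D p.2) (fun s =>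
          P.cost π.first + ∑ j, P.cost (π.second (List.ofFn fun t => s (j, t)))) :=
        expect_mono (indepPMF _) hpoint
    _ = P.cost π.first + k * E := by
        rw [expectIndep_eq_expect, expect_add, expect_const, expect_sum]
        have : ∀ j : Fin k, expect (indepPMF fun p : Fin k × Fin n => D p.2)
            (fun s => P.cost (π.second (List.ofFn fun t => s (j, t)))) = E := fun j =>
          expectIndep_marginal ⟨fun t : Fin n => (j, t), fun a b h => (Prod.mk.inj h).2⟩
            (fun p : Fin k × Fin n => D p.2) fun v => P.cost (π.second (List.ofFn v))
        simp [this]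
    _ ≤ 2 * P.cost π.first + 2 * (ENNReal.ofReal lam * E) := by
        refine add_le_add (le_mul_of_one_le_left' one_le_two) ?_
        rw [← mul_assoc]
        refine mul_le_mul_left ?_ _
        calc (k : ℝ≥0∞) = ENNReal.ofReal k := by simp
          _ ≤ ENNReal.ofReal (2 * lam) := ENNReal.ofReal_le_ofReal hk
          _ = 2 * ENNReal.ofReal lam := by rw [ENNReal.ofReal_mul zero_le_two]; simp
    _ = 2 * expectIndep D (fun v => π.totalCost lam (List.ofFn v)) := by
        rw [← mul_add, hE, expectIndep_eq_expect, expectIndep_eq_expect, ← expect_const_mul]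
        simp only [TwoStagePolicy.totalCost]
        rw [expect_add, expect_const]

theorem expectSubset_mono (U : Finset V) (k : ℕ) {g h : Finset V → ℝ≥0∞}
    (H : ∀ S ∈ U.powersetCard k, g S ≤ h S) : expectSubset U k g ≤ expectSubset U k h :=
  ENNReal.div_le_div_right (Finset.sum_le_sum H) _

variable [Nonempty (Fin m)]

open Classical in
/-- The algorithm that follows an optimal plan for the sampled requests. -/
def prophetAlg (k n : ℕ) : (Fin k × Fin n → V) →
    OnlinePolicy (facilityLocation openCost connCost) ∅ :=
  fun s => planPolicy openCost connCost (Finset.univ.image s) ∅ (Set.empty_subset _)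

theorem prophetAlg_cost_le (hm : 1 ≤ m) {n : ℕ} (hn : 1 ≤ n) (D : Fin n → PMF V) :
    expectIndep (fun p : Fin 1 × Fin n => D p.2) (fun s => expectIndep D fun v =>
      (facilityLocation openCost connCost).cost
        ((prophetAlg openCost connCost 1 n s).sol (List.ofFn v))) ≤
    ENNReal.ofReal ((1 + 52) * (1 + Real.log (m * n))) *
      prophetOpt (facilityLocation openCost connCost) D := by
  classical
  have hlog : 0 ≤ Real.log m := Real.log_nonneg (by exact_mod_cast hm)
  have hll := one_add_log_le hm hn
  have h := mul_expectIndep_missed_le openCost connCost hm 1 D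
  rw [Nat.cast_one, one_mul, expectIndep_opt_one] at h
  refine le_trans ?_ (add_ofReal_mul_le (c := 52) (by norm_num) (by linarith) (by linarith) hll _)
  refine le_trans ?_ (add_le_add_right h _)
  rw [← expectIndep_opt_one, expectIndep_eq_expect, expectIndep_eq_expect, expectIndep_eq_expect,
    ← expect_add]
  refine expect_mono _ fun s => ?_
  simp only [expectIndep_eq_expect]
  rw [← expect_const (indepPMF D) ((facilityLocation openCost connCost).opt _), ← expect_add]
  refine expect_mono _ fun v => ?_
  exact cost_planPolicy_le openCost connCost _ _ _ _

theorem exists_sampleProphetAlg (hm : 1 ≤ m) {n : ℕ} (hn : 1 ≤ n) :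
    ∃ A : SampleProphetAlg (facilityLocation openCost connCost) 1 n, ∀ D : Fin n → PMF V,
      A.expCost D ≤ ENNReal.ofReal (106 * (1 + Real.log (m * n))) *
        prophetOpt (facilityLocation openCost connCost) D := by
  refine ⟨PMF.pure (prophetAlg openCost connCost 1 n), fun D => ?_⟩
  rw [SampleProphetAlg.expCost, expect_pure]
  refine (prophetAlg_cost_le openCost connCost hm hn D).trans ?_
  have hlog : 0 ≤ Real.log m := Real.log_nonneg (by exact_mod_cast hm)
  have hll := one_add_log_le hm hn
  exact mul_le_mul_left (ENNReal.ofReal_le_ofReal (by linarith)) _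

theorem exists_twoStageAlg (hm : 1 ≤ m) {n : ℕ} (hn : 1 ≤ n) {lam : ℝ} (hlam : 0 < lam) :
    ∃ A : TwoStageAlg (facilityLocation openCost connCost) ⌈lam⌉₊ n, ∀ D : Fin n → PMF V,
      A.expCost lam D ≤ ENNReal.ofReal (106 * (1 + Real.log (m * n))) *
        twoStageOnlineOpt (facilityLocation openCost connCost) lam D := by
  classical
  have hlog : 0 ≤ Real.log m := Real.log_nonneg (by exact_mod_cast hm)
  have hll := one_add_log_le hm hn
  -- For `lam ≤ 1` there is one sample per distribution and everything is bought in the second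
  -- stage. For `lam ≥ 1` the plan is bought in the first stage; `lam ≤ k` lets the missed-cost
  -- bound absorb the markup, and `k ≤ 2 * lam` controls the optimum on the samples.
  rcases le_total lam 1 with h1 | h1
  · have hceil : ⌈lam⌉₊ = 1 :=
      le_antisymm (Nat.ceil_le.2 (by simpa using h1)) (Nat.ceil_pos.2 hlam)
    rw [hceil]
    refine ⟨PMF.pure fun s => TwoStagePolicy.ofOnline (prophetAlg openCost connCost 1 n s),
      fun D => ?_⟩
    rw [TwoStageAlg.expCost, expect_pure]
    have e : ∀ s (v : Fin n → V), (TwoStagePolicy.ofOnline (prophetAlg openCost connCost 1 n s)).totalCost lam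
        (List.ofFn v) = ENNReal.ofReal lam * (facilityLocation openCost connCost).cost
          ((prophetAlg openCost connCost 1 n s).sol (List.ofFn v)) := fun s v => by
      simp [TwoStagePolicy.totalCost, TwoStagePolicy.ofOnline, RequestProgram.cost_zero]
    simp only [e, expectIndep_eq_expect, expect_const_mul]
    refine (mul_le_mul_right (prophetAlg_cost_le openCost connCost hm hn D) _).trans ?_
    rw [mul_left_comm]
    exact mul_le_mul' (ENNReal.ofReal_le_ofReal (by linarith))
      (lam_mul_prophetOpt_le openCost connCost h1 D)
  · set k := ⌈lam⌉₊
    have hk2 : (k : ℝ) ≤ 2 * lam := by linarith [Nat.ceil_lt_add_one hlam.le]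
    refine ⟨PMF.pure fun s => planTwoStage openCost connCost (Finset.univ.image s), fun D => ?_⟩
    rw [TwoStageAlg.expCost, expect_pure]
    set E := expectIndep (fun p : Fin k × Fin n => D p.2) (fun s =>
      (facilityLocation openCost connCost).opt ((Finset.univ.image s : Finset V) : Set V)) with hE
    have h := mul_expectIndep_missed_le openCost connCost hm k D
    rw [← hE] at h
    calc _ ≤ E + ENNReal.ofReal (52 * (1 + Real.log m)) * E := by
          refine le_trans ?_ (add_le_add_right h _)
          rw [hE, expectIndep_eq_expect, expectIndep_eq_expect, expectIndep_eq_expect,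
            ← expect_const_mul, ← expect_add]
          refine expect_mono _ fun s => ?_
          simp only [expectIndep_eq_expect]
          rw [← expect_const (indepPMF D) ((facilityLocation openCost connCost).opt _),
            ← expect_const_mul, ← expect_add]
          refine expect_mono _ fun v =>
            (totalCost_planTwoStage_le openCost connCost _ lam _).trans ?_
          refine add_le_add_right (mul_le_mul_left ?_ _) _
          calc ENNReal.ofReal lam ≤ ENNReal.ofReal k := ENNReal.ofReal_le_ofReal (Nat.le_ceil lam)
            _ = k := by simp
      _ ≤ ENNReal.ofReal ((1 + 52) * (1 + Real.log (m * n))) * E :=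
          add_ofReal_mul_le (by norm_num) (by linarith) (by linarith) hll _
      _ ≤ ENNReal.ofReal ((1 + 52) * (1 + Real.log (m * n))) *
            (2 * twoStageOnlineOpt (facilityLocation openCost connCost) lam D) :=
          mul_le_mul_right (expectIndep_opt_le_twoStage openCost connCost hk2 D) _
      _ = ENNReal.ofReal (106 * (1 + Real.log (m * n))) *
            twoStageOnlineOpt (facilityLocation openCost connCost) lam D := by
          rw [← mul_assoc]
          congr 1
          rw [mul_comm, ← ENNReal.ofReal_ofNat 2, ← ENNReal.ofReal_mul zero_le_two]
          congr 1
          ring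

/-- The arrival order is irrelevant, since clients outside `S` are served independently of each
other. Sampling gives each client mass `k / #U`, so undoing this loses a factor `#U / k`. -/
theorem expectSubset_planPolicy_le (hm : 1 ≤ m) {U : Finset V} (hU : U.Nonempty) {α : ℝ}
    (hα : 0 < α) (hα1 : α ≤ 1) {order : Finset V → List V} (horder : IsArrivalOrder U order) :
    expectSubset U ⌊α * U.card⌋₊ (fun S => (facilityLocation openCost connCost).cost
      ((planPolicy openCost connCost S S le_rfl).sol (order S))) ≤
    ENNReal.ofReal (106 * (1 + Real.log (m * U.card)) / α) *
      (facilityLocation openCost connCost).opt (U : Set V) := by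
  classical
  set P := facilityLocation openCost connCost with hP
  have hlog : 0 ≤ Real.log m := Real.log_nonneg (by exact_mod_cast hm)
  have hN : 1 ≤ U.card := Finset.card_pos.2 hU
  have hN' : (0 : ℝ) < U.card := by exact_mod_cast hN
  have hll := one_add_log_le hm hN
  have hainv : 1 ≤ 1 / α := (one_le_div hα).2 hα1
  set k := ⌊α * U.card⌋₊ with hk
  have hkU : k ≤ U.card := by
    refine Nat.floor_le_of_le ?_
    exact mul_le_of_le_one_left hN'.le hα1
  have hne : (U.powersetCard k).Nonempty := Finset.powersetCard_nonempty.2 hkU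
  have hexp : ∀ g, expectSubset U k g = expect (PMF.uniformOfFinset _ hne) g := fun g =>
    (expect_uniformOfFinset _ hne g).symm
  have hopt : expectSubset U k (fun S => P.opt S) ≤ P.opt U := by
    refine (expectSubset_mono U k fun S hS => facilityLocation_opt_mono openCost connCost
      (Finset.coe_subset.2 (Finset.mem_powersetCard.1 hS).1)).trans ?_
    rw [hexp, expect_const]
  have hcost : ∀ S ∈ U.powersetCard k,
      P.cost ((planPolicy openCost connCost S S le_rfl).sol (order S)) ≤
        P.opt S + ∑' u, (S : Set V)ᶜ.indicator ((U : Set V).indicator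
          (serveCost openCost connCost (planFacilities openCost connCost S))) u := by
    intro S hS
    refine (cost_planPolicy_le openCost connCost S S le_rfl _).trans
      (add_le_add_right (ENNReal.tsum_le_tsum fun u => ?_) _)
    rw [Set.indicator_indicator]
    refine Set.indicator_le_indicator_of_subset ?_ (fun _ => zero_le) u
    rintro w ⟨hw1, hw2⟩
    exact ⟨hw2, (((horder S (Finset.mem_powersetCard.1 hS).1).2 w).1 hw1).1⟩
  -- An empty sample means `#U < 1 / α`, so it suffices that each client alone costs at most `opt
  -- U`.
  rcases Nat.eq_zero_or_pos k with hk0 | hk0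
  · have hsmall : α * U.card < 1 := Nat.floor_eq_zero.1 hk0
    have hcardα : (U.card : ℝ) ≤ 1 / α := by
      rw [le_div_iff₀ hα]
      linarith
    calc _ ≤ expectSubset U k (fun _ => P.opt U + U.card * P.opt U) := by
          refine expectSubset_mono U k fun S hS => (hcost S hS).trans (add_le_add
            (facilityLocation_opt_mono openCost connCost
              (Finset.coe_subset.2 (Finset.mem_powersetCard.1 hS).1)) ?_)
          refine (ENNReal.tsum_le_tsum fun u =>
            Set.indicator_le_self' (fun _ _ => zero_le) u).trans ?_
          rw [tsum_indicator_coe_finset]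
          refine (Finset.sum_le_card_nsmul U _ (P.opt U) fun u hu => ?_).trans (by simp)
          exact (serveCost_anti openCost connCost (Finset.empty_subset _) u).trans
            (serveCost_empty_le_opt openCost connCost hu)
      _ = (1 + U.card) * P.opt U := by rw [hexp, expect_const, add_mul, one_mul]
      _ = ENNReal.ofReal (1 + U.card) * P.opt U := by
          rw [ENNReal.ofReal_add zero_le_one (by positivity)]
          simp
      _ ≤ _ := by
          refine mul_le_mul_left (ENNReal.ofReal_le_ofReal ?_) _
          rw [mul_div_assoc, mul_comm, div_eq_mul_one_div]
          nlinarith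
  · have hk1 : (1 : ℝ) ≤ k := by exact_mod_cast hk0
    have hfl : α * U.card < k + 1 := Nat.lt_floor_add_one _
    -- Rounding down costs at most a factor 2: `α * #U < k + 1 ≤ 2 * k`.
    have hratio : (U.card : ℝ) / k ≤ 2 / α := by
      rw [div_le_div_iff₀ (by linarith) hα]
      linarith
    have hmass : ∀ u ∈ U, (uniformMass U k u : ℝ≥0∞) * ENNReal.ofReal (U.card / k) = 1 := by
      intro u hu
      have hk' : (k : ℝ) ≠ 0 := by linarith
      rw [← ENNReal.ofReal_coe_nnreal, ← ENNReal.ofReal_mul (by positivity)]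
      simp only [uniformMass, Finset.mem_coe, hu, Set.indicator_of_mem]
      push_cast
      rw [div_mul_div_cancel₀ hN'.ne', div_self hk', ENNReal.ofReal_one]
    have hmiss := (isExpBalanced_subset U k hne).expect_missed_le openCost connCost hm
    rw [← hexp, ← hexp] at hmiss
    set M := expectSubset U k fun S => ∑' u, ((S : Set V)ᶜ).indicator (fun u =>
      (uniformMass U k u : ℝ≥0∞) *
        serveCost openCost connCost (planFacilities openCost connCost S) u) u with hM
    calc _ ≤ expectSubset U k (fun S => P.opt S + ENNReal.ofReal (U.card / k) *
            ∑' u, ((S : Set V)ᶜ).indicator (fun u => (uniformMass U k u : ℝ≥0∞) *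
              serveCost openCost connCost (planFacilities openCost connCost S) u) u) := by
          refine expectSubset_mono U k fun S hS => (hcost S hS).trans (add_le_add_right ?_ _)
          rw [← ENNReal.tsum_mul_left]
          refine ENNReal.tsum_le_tsum fun u => ?_
          by_cases hu : u ∈ S
          · simp [hu]
          · have hu' : u ∈ (S : Set V)ᶜ := by simpa using hu
            rw [Set.indicator_of_mem hu', Set.indicator_of_mem hu']
            by_cases huU : u ∈ U
            · rw [Set.indicator_of_mem (Finset.mem_coe.2 huU), ← mul_assoc,
                mul_comm (ENNReal.ofReal _), hmass u huU, one_mul]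
            · simp [huU]
      _ = expectSubset U k (fun S => P.opt S) + ENNReal.ofReal (U.card / k) * M := by
          rw [hM, hexp, hexp, hexp, expect_add, expect_const_mul]
      _ ≤ P.opt U + ENNReal.ofReal (2 / α) *
            (ENNReal.ofReal (52 * (1 + Real.log m)) * P.opt U) := by
          refine add_le_add hopt (mul_le_mul' (ENNReal.ofReal_le_ofReal hratio) ?_)
          exact hmiss.trans (mul_le_mul_right hopt _)
      _ = ENNReal.ofReal (1 + 2 / α * (52 * (1 + Real.log m))) * P.opt U := by
          rw [ENNReal.ofReal_add zero_le_one (by positivity), ENNReal.ofReal_one, add_mul,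
            one_mul, ENNReal.ofReal_mul (p := 2 / α) (by positivity), mul_assoc]
      _ ≤ _ := by
          refine mul_le_mul_left (ENNReal.ofReal_le_ofReal ?_) _
          have e1 : 2 / α * (52 * (1 + Real.log m)) = 104 * ((1 / α) * (1 + Real.log m)) := by
            ring
          have e2 : 106 * (1 + Real.log (m * U.card)) / α =
              106 * ((1 / α) * (1 + Real.log (m * U.card))) := by ring
          rw [e1, e2]
          have h1 : (1 / α) * (1 + Real.log m) ≤ (1 / α) * (1 + Real.log (m * U.card)) := by
            gcongr
          have h2 : 1 ≤ (1 / α) * (1 + Real.log m) := by nlinarith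
          linarith

end Settings

end OnlineIP

end

theorem mainTheorem9 :
    ∃ C : ℝ, 0 < C ∧
      ∀ (m : ℕ) (_ : 1 ≤ m) (V : Type u)
        (openCost : Fin m → ℝ≥0) (connCost : Fin m → V → ℝ≥0∞),
        -- single-sample prophet setting
        (∀ (n : ℕ) (_ : 1 ≤ n),
          ∃ A : OnlineIP.SampleProphetAlg (OnlineIP.facilityLocation openCost connCost) 1 n,
            ∀ D : Fin n → PMF V,
              A.expCost D ≤
                ENNReal.ofReal (C * (1 + Real.log (m * n))) *
                  OnlineIP.prophetOpt (OnlineIP.facilityLocation openCost connCost) D) ∧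
        -- two-stage prophet setting, against the optimal online policy
        (∀ (n : ℕ) (_ : 1 ≤ n) (lam : ℝ) (_ : 0 < lam),
          ∃ A : OnlineIP.TwoStageAlg (OnlineIP.facilityLocation openCost connCost) ⌈lam⌉₊ n,
            ∀ D : Fin n → PMF V,
              A.expCost lam D ≤
                ENNReal.ofReal (C * (1 + Real.log (m * n))) *
                  OnlineIP.twoStageOnlineOpt
                    (OnlineIP.facilityLocation openCost connCost) lam D) ∧
        -- online-with-a-sample setting
        (∃ A : OnlineIP.OnlineWithSampleAlg (OnlineIP.facilityLocation openCost connCost),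
          ∀ (U : Finset V) (_ : U.Nonempty) (α : ℝ) (_ : 0 < α) (_ : α ≤ 1)
            (order : Finset V → List V) (_ : OnlineIP.IsArrivalOrder U order),
              A.expCost U ⌊α * U.card⌋₊ order ≤
                ENNReal.ofReal (C * (1 + Real.log (m * U.card)) / α) *
                  (OnlineIP.facilityLocation openCost connCost).opt (U : Set V)) := by
  -- The two-stage setting dictates `106 = 2 * (1 + 52)`; the others need at most `1 + 2 * 52`.
  refine ⟨106, by norm_num, fun m hm V openCost connCost => ?_⟩
  have : Nonempty (Fin m) := ⟨⟨0, hm⟩⟩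
  refine ⟨fun n hn => OnlineIP.exists_sampleProphetAlg openCost connCost hm hn,
    fun n hn lam hlam => OnlineIP.exists_twoStageAlg openCost connCost hm hn hlam,
    PMF.pure fun S => OnlineIP.planPolicy openCost connCost S S le_rfl,
    fun U hU α hα hα1 order horder => ?_⟩
  rw [OnlineIP.OnlineWithSampleAlg.expCost, OnlineIP.expect_pure]
  exact OnlineIP.expectSubset_planPolicy_le openCost connCost hm hU hα hα1 horder
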